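/- Let $\theta_{ab}(z,\tau)=\sum_{n\in\mathbb Z}\exp\big(\pi i(\tfrac a2+n)^2\tau+2\pi i(\tfrac a2+n)(\tfrac b2+z)\big)$ with $\tau\in i\mathbb R_{>0}$. Let $N\ge 1$ be an integer and $l\in\frac12\mathbb Z_{>0}$ with $Nl\in\mathbb Z$, and let $\eta=\frac{r'}{2lr}$ with $r,r'\in\mathbb Z$, $r>0$, $\eta\neq 0$ and $|\eta|\le\frac{1}{2(2l+1)}$ (these conditions force $r\ge 3$). Write $[z]=\theta_{11}(z,\tau)$, $[z]_k=\prod_{j=0}^{k-1}[z+2j\eta]$ and $[z;a]_k=[z+a]_k[-z+a]_k$. *Transfer matrix.* Let $\Theta^{4l+}_{00}$ be the space of entire functions $f$ with $f(z+1)=f(-z)=f(z)$ and $f(z+\tau)=e^{-4l\pi i(2z+\tau)}f(z)$. For $a=0,1,2,3$ let $\vartheta_a=\theta_{11},\theta_{10},\theta_{00},\theta_{01}$ (with modulus $\tau$), $W_a(u)=\vartheta_a(u)/\vartheta_a(\eta)$, $s_a(z)=c_a\vartheta_a(\eta)\vartheta_a(2z)$ with $c_0=c_1=c_3=1$, $c_2=i$,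 and let $\rho^l(S^a)$ be the operator on $\Theta^{4l+}_{00}$ $$(\rho^l(S^a)f)(z)=\frac{s_a(z-l\eta)f(z+\eta)-s_a(-z-l\eta)f(z-\eta)}{\theta_{11}(2z,\tau)}$$ (the singularities on the right are removable). Let $\mathcal H=V_N\otimes\cdots\otimes V_1$ with every $V_n=\Theta^{4l+}_{00}$, let $\sigma^0,\dots,\sigma^3$ be the identity and the Pauli matrices, let $L_n(u)=\sum_{a=0}^3W_a(u)\,\rho_n(S^a)\otimes\sigma^a$, where $\rho_n(S^a)$ acts as $\rho^l(S^a)$ on the factor $V_n$ and as the identity on the others, and let $T(u)=\operatorname{tr}_{\mathbb C^2}L_N(u)\cdots L_1(u)$, an operator on $\mathcal H$. *The operator $Q_R$.* For $\lambda,u\in\mathbb C$ let $f_\pm(\lambda,u,z)=\big[z;\tfrac{\pm\lambda+u}{2}+(1-l)\eta\big]_{2l}$, which lies in $\Theta^{4l+}_{00}$ as a function of $z$. Let $m\geq 0$ be an integer (for example $m=2l+1$), let $e_1,\dots,e_m$ be the standard basis of $\mathbb C^m$, and let $\tau_{kj}\in\mathbb C$ ($1\le k\le m$, $1\le j\le r$)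 be arbitrary. Let $S(u)=(S^i_j(u))_{i,j=1}^r$ be the tridiagonal matrix of linear maps $\mathbb C^m\to\Theta^{4l+}_{00}$ given by $$S^{j\pm1}_j(u)e_k=\tau_{kj}f_\pm(2(2j-1)l\eta,u,z),\quad S^1_1(u)e_k=\tau_{k1}f_-(2l\eta,u,z),\quad S^r_r(u)e_k=\tau_{kr}f_+(2(2r-1)l\eta,u,z),$$ all other entries being $0$. Let $Q_R(u)=\operatorname{tr}_{\mathbb C^r}S_N(u)\cdots S_1(u)$, where $S_n(u)$ is $S(u)$ acting on the $n$-th tensor factor, that is $$Q_R(u)=\sum_{i_1,\dots,i_N=1}^r S^{i_N}_{i_{N-1}}(u)\otimes S^{i_{N-1}}_{i_{N-2}}(u)\otimes\cdots\otimes S^{i_1}_{i_N}(u):(\mathbb C^m)^{\otimes N}\to\mathcal H .$$ *Claim.* For all $u\in\mathbb C$, $$T(u)Q_R(u)=h_-(u)\,Q_R(u-2\eta)+h_+(u)\,Q_R(u+2\eta),\qquad h_\pm(u)=(2[u\mp2l\eta])^N .$$ -/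

import Mathlib

open Complex Filter Topology

noncomputable section

namespace EightVertex

/-! ### Theta functions -/

/-- Mumford's theta function with characteristics `θ_{ab}(z, τ)`. -/
def theta (a b : ℕ) (z τ : ℂ) : ℂ :=
  ∑' n : ℤ, cexp (Real.pi * I * ((a : ℂ) / 2 + n) ^ 2 * τ
    + 2 * Real.pi * I * ((a : ℂ) / 2 + n) * ((b : ℂ) / 2 + z))

lemma theta_eq (a b : ℕ) (z τ : ℂ) : theta a b z τ =
    cexp (Real.pi * I * ((a : ℂ) / 2) ^ 2 * τ + 2 * Real.pi * I * ((a : ℂ) / 2) * ((b : ℂ) / 2 + z))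
      * jacobiTheta₂ ((b : ℂ) / 2 + z + (a : ℂ) / 2 * τ) τ := by
  rw [theta, jacobiTheta₂, ← tsum_mul_left]
  refine tsum_congr fun n => ?_
  rw [jacobiTheta₂_term, ← Complex.exp_add]
  congr 1
  ring

lemma differentiable_theta (a b : ℕ) (τ : UpperHalfPlane) :
    Differentiable ℂ fun z => theta a b z τ := by
  simp only [theta_eq]
  intro z
  have h := differentiableAt_jacobiTheta₂_fst ((b : ℂ) / 2 + z + (a : ℂ) / 2 * τ) τ.im_pos
  have h2 : DifferentiableAt ℂ (fun z : ℂ =>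
      jacobiTheta₂ ((b : ℂ) / 2 + z + (a : ℂ) / 2 * τ) τ) z :=
    DifferentiableAt.comp z (g := fun w => jacobiTheta₂ w τ)
      (f := fun z : ℂ => (b : ℂ) / 2 + z + (a : ℂ) / 2 * τ) h (by fun_prop)
  exact DifferentiableAt.fun_mul (by fun_prop) h2

lemma theta_add_one (a b : ℕ) (z τ : ℂ) : theta a b (z + 1) τ = (-1) ^ a * theta a b z τ := by
  rw [theta, theta, ← tsum_mul_left]
  refine tsum_congr fun n => ?_
  rw [← Complex.exp_pi_mul_I, ← Complex.exp_nat_mul, ← Complex.exp_add,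
    Complex.exp_eq_exp_iff_exists_int]
  exact ⟨n, by ring⟩

lemma theta_add_tau (a b : ℕ) (z τ : ℂ) : theta a b (z + τ) τ =
    (-1) ^ b * cexp (-(Real.pi * I * (2 * z + τ))) * theta a b z τ := by
  rw [theta, theta, ← tsum_mul_left, ← (Equiv.addRight (1 : ℤ)).tsum_eq
    (fun n : ℤ => (-1 : ℂ) ^ b * cexp (-(Real.pi * I * (2 * z + τ))) *
      cexp (Real.pi * I * ((a : ℂ) / 2 + n) ^ 2 * τ
        + 2 * Real.pi * I * ((a : ℂ) / 2 + n) * ((b : ℂ) / 2 + z)))]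
  refine tsum_congr fun n => ?_
  rw [← Complex.exp_pi_mul_I, ← Complex.exp_nat_mul, ← Complex.exp_add, ← Complex.exp_add,
    Complex.exp_eq_exp_iff_exists_int]
  refine ⟨-b, ?_⟩
  simp only [Equiv.coe_addRight]
  push_cast
  ring

lemma theta_one_one_neg (z τ : ℂ) : theta 1 1 (-z) τ = -theta 1 1 z τ := by
  rw [theta, theta, ← tsum_neg, ← (Equiv.subLeft (-1 : ℤ)).tsum_eq
    (fun n : ℤ => cexp (Real.pi * I * (((1 : ℕ) : ℂ) / 2 + n) ^ 2 * τ
        + 2 * Real.pi * I * (((1 : ℕ) : ℂ) / 2 + n) * (((1 : ℕ) : ℂ) / 2 + -z)))]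
  refine tsum_congr fun n => ?_
  rw [neg_eq_neg_one_mul (cexp _), ← Complex.exp_pi_mul_I, ← Complex.exp_add,
    Complex.exp_eq_exp_iff_exists_int]
  refine ⟨-n - 1, ?_⟩
  simp only [Equiv.subLeft_apply]
  push_cast
  ring

/-! ### Division of entire functions -/

/-- The quotient `f / g` with simple zeros of `g` filled in by l'Hôpital's rule. -/
def quot (f g : ℂ → ℂ) (z : ℂ) : ℂ :=
  if g z = 0 then deriv f z / deriv g z else f z / g z

lemma mul_quot {f g : ℂ → ℂ} (h0 : ∀ z, g z = 0 → f z = 0) (z : ℂ) :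
    g z * quot f g z = f z := by
  unfold quot
  split_ifs with h
  · rw [h, zero_mul, h0 z h]
  · field_simp

lemma eventually_ne_of_simple {g : ℂ → ℂ} (hg : Differentiable ℂ g)
    (h1 : ∀ z, g z = 0 → deriv g z ≠ 0) (z : ℂ) : ∀ᶠ w in 𝓝[≠] z, g w ≠ 0 := by
  by_cases h : g z = 0
  · have := (hg z).hasDerivAt.eventually_ne (c := 0) (h1 z h)
    exact this
  · exact ((hg z).continuousAt.eventually_ne h).filter_mono nhdsWithin_le_nhds

lemma differentiable_quot {f g : ℂ → ℂ} (hf : Differentiable ℂ f) (hg : Differentiable ℂ g)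
    (h0 : ∀ z, g z = 0 → f z = 0) (h1 : ∀ z, g z = 0 → deriv g z ≠ 0) :
    Differentiable ℂ (quot f g) := by
  intro z
  by_cases h : g z = 0
  · have hdf : DifferentiableAt ℂ (dslope f z) z :=
      ((Complex.differentiableOn_dslope (s := Set.univ) Filter.univ_mem).2
        hf.differentiableOn).differentiableAt Filter.univ_mem
    have hdg : DifferentiableAt ℂ (dslope g z) z :=
      ((Complex.differentiableOn_dslope (s := Set.univ) Filter.univ_mem).2
        hg.differentiableOn).differentiableAt Filter.univ_mem
    have hne : dslope g z z ≠ 0 := by rw [dslope_same]; exact h1 z h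
    refine (hdf.fun_div hdg hne).congr_of_eventuallyEq ?_
    have hev := eventually_ne_of_simple hg h1 z
    rw [eventually_nhdsWithin_iff] at hev
    filter_upwards [hev] with w hw
    by_cases hwz : w = z
    · subst hwz
      simp [quot, h, dslope_same]
    · have hgw := hw hwz
      have hsub : w - z ≠ 0 := sub_ne_zero.2 hwz
      rw [quot, if_neg hgw, dslope_of_ne _ hwz, dslope_of_ne _ hwz, slope_def_field,
        slope_def_field, h, h0 z h, sub_zero, sub_zero]
      field_simp
  · refine ((hf z).fun_div (hg z) h).congr_of_eventuallyEq ?_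
    filter_upwards [(hg z).continuousAt.eventually_ne h] with w hw
    simp [quot, hw]

lemma cancel_left {a b g : ℂ → ℂ} (hg : Differentiable ℂ g)
    (h1 : ∀ z, g z = 0 → deriv g z ≠ 0) (ha : Continuous a) (hb : Continuous b)
    (hab : ∀ z, g z * a z = g z * b z) (z : ℂ) : a z = b z := by
  have ha' : Tendsto a (𝓝[≠] z) (𝓝 (a z)) := ha.continuousAt.tendsto.mono_left nhdsWithin_le_nhds
  have hb' : Tendsto b (𝓝[≠] z) (𝓝 (b z)) := hb.continuousAt.tendsto.mono_left nhdsWithin_le_nhds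
  refine tendsto_nhds_unique ha' (hb'.congr' ?_)
  filter_upwards [eventually_ne_of_simple hg h1 z] with w hw
  exact (mul_left_cancel₀ hw (hab w)).symm

/-! ### The zeros of `θ₁₁` -/

/-- The product `∏ (1 - qⁿ x)`. -/
def eulerProd (q x : ℂ) : ℂ := ∏' n : ℕ, (1 + -(q ^ n * x))

lemma summable_eulerProd {q : ℂ} (hq : ‖q‖ < 1) (x : ℂ) :
    Summable fun n : ℕ => ‖-(q ^ n * x)‖ := by
  simpa using (summable_geometric_of_lt_one (norm_nonneg _) hq).mul_right ‖x‖

lemma eulerProd_eq {q : ℂ} (hq : ‖q‖ < 1) (x : ℂ) :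
    eulerProd q x = (1 - x) * eulerProd q (q * x) := by
  have e : ∀ n : ℕ, (1 : ℂ) + -(q ^ (n + 1) * x) = 1 + -(q ^ n * (q * x)) := fun n => by ring
  have h := multipliable_one_add_of_summable (summable_eulerProd hq (q * x))
  rw [eulerProd, tprod_eq_zero_mul' (by simpa only [e] using h), eulerProd]
  simp only [e, pow_zero, one_mul, sub_eq_add_neg]

lemma exists_of_eulerProd_eq_zero {q : ℂ} (hq : ‖q‖ < 1) {x : ℂ} (h : eulerProd q x = 0) :
    ∃ n : ℕ, q ^ n * x = 1 := by
  by_contra! hne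
  refine tprod_one_add_ne_zero_of_summable (fun n => ?_) (summable_eulerProd hq x) h
  rw [← sub_eq_add_neg]
  exact sub_ne_zero.2 (hne n).symm

lemma differentiable_eulerProd {q : ℂ} (hq : ‖q‖ < 1) : Differentiable ℂ (eulerProd q) := by
  intro x
  have hs : Summable fun n : ℕ => ‖q‖ ^ n * (‖x‖ + 1) :=
    (summable_geometric_of_lt_one (norm_nonneg _) hq).mul_right _
  have hp := hs.hasProdLocallyUniformlyOn_nat_one_add
    (f := fun (n : ℕ) (y : ℂ) => -(q ^ n * y)) (Metric.isOpen_ball (x := (0 : ℂ)) (ε := ‖x‖ + 1))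
    (.of_forall fun n y hy => by
      rw [norm_neg, norm_mul, norm_pow]
      have : ‖y‖ < ‖x‖ + 1 := by simpa using hy
      gcongr) (fun n => by fun_prop)
  have hd := hp.differentiableOn (.of_forall fun s => by
    simpa [Finset.prod_fn] using DifferentiableOn.finsetProd (fun _ _ => by fun_prop))
    Metric.isOpen_ball
  exact hd.differentiableAt (Metric.isOpen_ball.mem_nhds (by simp))

/-- The product form of `θ₁₁`, up to an elementary factor. -/
def thetaProd (τ z : ℂ) : ℂ :=
  eulerProd (cexp (2 * Real.pi * I * τ)) (cexp (2 * Real.pi * I * z)) *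
    eulerProd (cexp (2 * Real.pi * I * τ))
      (cexp (2 * Real.pi * I * τ) * cexp (-(2 * Real.pi * I * z)))

lemma differentiable_thetaProd (τ : UpperHalfPlane) : Differentiable ℂ (thetaProd τ) := by
  have h := differentiable_eulerProd τ.norm_exp_two_pi_I_lt_one
  unfold thetaProd
  exact (h.comp (by fun_prop)).fun_mul (h.comp (by fun_prop))

lemma thetaProd_add_one (τ z : ℂ) : thetaProd τ (z + 1) = thetaProd τ z := by
  have h1 : cexp (2 * Real.pi * I * (z + 1)) = cexp (2 * Real.pi * I * z) :=
    Complex.exp_eq_exp_iff_exists_int.2 ⟨1, by push_cast; ring⟩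
  rw [thetaProd, thetaProd, Complex.exp_neg, Complex.exp_neg, h1]

lemma thetaProd_add_tau (τ : UpperHalfPlane) (z : ℂ) :
    thetaProd τ (z + τ) = -cexp (-(2 * Real.pi * I * z)) * thetaProd τ z := by
  have hq := τ.norm_exp_two_pi_I_lt_one
  have h1 : cexp (2 * Real.pi * I * (z + τ)) =
      cexp (2 * Real.pi * I * τ) * cexp (2 * Real.pi * I * z) := by
    rw [← Complex.exp_add]; ring_nf
  have h2 : cexp (2 * Real.pi * I * τ) * cexp (-(2 * Real.pi * I * (z + τ))) =
      cexp (-(2 * Real.pi * I * z)) := by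
    rw [← Complex.exp_add]; ring_nf
  have h3 : cexp (-(2 * Real.pi * I * z)) * cexp (2 * Real.pi * I * z) = 1 := by
    rw [← Complex.exp_add]; simp
  rw [thetaProd, thetaProd, h1, h2, eulerProd_eq hq (cexp (-(2 * Real.pi * I * z))),
    eulerProd_eq hq (cexp (2 * Real.pi * I * z))]
  linear_combination (eulerProd (cexp (2 * Real.pi * I * τ))
    (cexp (2 * Real.pi * I * τ) * cexp (2 * Real.pi * I * z)) *
    eulerProd (cexp (2 * Real.pi * I * τ))
    (cexp (2 * Real.pi * I * τ) * cexp (-(2 * Real.pi * I * z)))) * (-h3)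

lemma exists_of_thetaProd_eq_zero (τ : UpperHalfPlane) {z : ℂ} (h : thetaProd τ z = 0) :
    ∃ m n : ℤ, z = m + n * τ := by
  have hq := τ.norm_exp_two_pi_I_lt_one
  have hpi : (2 * Real.pi * I : ℂ) ≠ 0 := Complex.two_pi_I_ne_zero
  rcases mul_eq_zero.1 h with h | h
  · obtain ⟨n, hn⟩ := exists_of_eulerProd_eq_zero hq h
    rw [← Complex.exp_nat_mul, ← Complex.exp_add, Complex.exp_eq_one_iff] at hn
    obtain ⟨m, hm⟩ := hn
    refine ⟨m, -n, mul_left_cancel₀ hpi ?_⟩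
    push_cast
    linear_combination hm
  · obtain ⟨n, hn⟩ := exists_of_eulerProd_eq_zero hq h
    rw [← Complex.exp_nat_mul, ← Complex.exp_add, ← Complex.exp_add,
      Complex.exp_eq_one_iff] at hn
    obtain ⟨m, hm⟩ := hn
    refine ⟨-m, n + 1, mul_left_cancel₀ hpi ?_⟩
    push_cast
    linear_combination -hm

lemma lattice_induction {p : ℂ → Prop} {τ : ℂ} (h0 : p 0) (h1 : ∀ z, p z ↔ p (z + 1))
    (hτ : ∀ z, p z ↔ p (z + τ)) (m n : ℤ) : p (m + n * τ) := by
  have hm : p m := by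
    induction m with
    | zero => simpa using h0
    | succ k ih => have := (h1 _).1 ih; push_cast at this ⊢; exact this
    | pred k ih =>
      rw [h1]; push_cast at ih ⊢; convert ih using 1; ring
  induction n with
  | zero => simpa using hm
  | succ k ih => have := (hτ _).1 ih; push_cast at this ⊢; convert this using 1; ring
  | pred k ih =>
    rw [hτ]; push_cast at ih ⊢; convert ih using 1; ring

lemma simple_zero_shift {F c : ℂ → ℂ} {ω : ℂ} (hF : Differentiable ℂ F) (hc : Differentiable ℂ c)
    (hc0 : ∀ z, c z ≠ 0) (h : ∀ z, F (z + ω) = c z * F z) (w : ℂ) :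
    (F w = 0 ∧ deriv F w ≠ 0) ↔ (F (w + ω) = 0 ∧ deriv F (w + ω) ≠ 0) := by
  have e1 : F (w + ω) = 0 ↔ F w = 0 := by rw [h, mul_eq_zero]; simp [hc0]
  have e2 : F w = 0 → deriv F (w + ω) = c w * deriv F w := by
    intro hw
    rw [← deriv_comp_add_const, funext h, deriv_fun_mul (hc w) (hF w), hw]
    ring
  constructor
  · rintro ⟨a, b⟩
    exact ⟨e1.2 a, by rw [e2 a]; exact mul_ne_zero (hc0 w) b⟩
  · rintro ⟨a, b⟩
    refine ⟨e1.1 a, fun b' => b ?_⟩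
    rw [e2 (e1.1 a), b', mul_zero]

lemma thetaProd_simple (τ : UpperHalfPlane) (m n : ℤ) :
    thetaProd τ (m + n * τ) = 0 ∧ deriv (thetaProd τ) (m + n * τ) ≠ 0 := by
  refine lattice_induction (p := fun w => thetaProd τ w = 0 ∧ deriv (thetaProd τ) w ≠ 0) ?_ ?_ ?_ m n
  · have hq := τ.norm_exp_two_pi_I_lt_one
    set q := cexp (2 * Real.pi * I * τ) with hqdef
    have hE := differentiable_eulerProd hq
    set U : ℂ → ℂ := fun z => eulerProd q (q * cexp (2 * Real.pi * I * z)) *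
      eulerProd q (q * cexp (-(2 * Real.pi * I * z))) with hU
    have hUd : Differentiable ℂ U :=
      (hE.comp (by fun_prop)).fun_mul (hE.comp (by fun_prop))
    have hPU : thetaProd τ = fun z => (1 - cexp (2 * Real.pi * I * z)) * U z := by
      funext z
      rw [thetaProd, ← hqdef, eulerProd_eq hq (cexp (2 * Real.pi * I * z)), hU]
      ring
    have hE1 : eulerProd q q ≠ 0 := by
      intro h
      obtain ⟨n, hn⟩ := exists_of_eulerProd_eq_zero hq h
      have : ‖q ^ n * q‖ < 1 := by
        rw [← pow_succ, norm_pow]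
        exact pow_lt_one₀ (norm_nonneg _) hq (by simp)
      rw [hn] at this
      simp at this
    have hU0 : U 0 ≠ 0 := by simp [hU, hE1]
    rw [hPU]
    refine ⟨by simp, ?_⟩
    have hx : HasDerivAt (fun z : ℂ => 1 - cexp (2 * Real.pi * I * z))
        (-(2 * Real.pi * I)) 0 := by
      have := (((hasDerivAt_id (0 : ℂ)).const_mul (2 * Real.pi * I : ℂ)).cexp).const_sub 1
      simpa using this
    rw [deriv_fun_mul hx.differentiableAt (hUd 0), hx.deriv]
    simp [hU0, Complex.I_ne_zero, Real.pi_ne_zero]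
  · exact simple_zero_shift (differentiable_thetaProd τ) (c := fun _ => 1) (by fun_prop) (by simp)
      (fun z => by rw [thetaProd_add_one, one_mul])
  · exact simple_zero_shift (differentiable_thetaProd τ) (by fun_prop)
      (fun z => neg_ne_zero.2 (Complex.exp_ne_zero _)) (thetaProd_add_tau τ)

lemma theta_one_one_lattice (τ : UpperHalfPlane) (m n : ℤ) : theta 1 1 (m + n * τ) τ = 0 := by
  refine lattice_induction (p := fun w => theta 1 1 w τ = 0) ?_ ?_ ?_ m n
  · have := theta_one_one_neg 0 τ
    rw [neg_zero] at this
    linear_combination this / 2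
  · intro z; rw [theta_add_one]; simp
  · intro z; rw [theta_add_tau]; simp

lemma exists_jacobiTheta₂_ne_zero (τ : UpperHalfPlane) : ∃ z : ℂ, jacobiTheta₂ z τ ≠ 0 := by
  by_contra! h0
  have hterm : ∀ (n : ℤ) (x : ℝ), jacobiTheta₂_term n x τ =
      cexp (Real.pi * I * n ^ 2 * τ) * cexp ((2 * Real.pi * I * n) * x) := fun n x => by
    rw [jacobiTheta₂_term, ← Complex.exp_add]; ring_nf
  let F : ℤ → C(ℝ, ℂ) := fun n => ⟨fun x => jacobiTheta₂_term n x τ, by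
    simp only [jacobiTheta₂_term]; fun_prop⟩
  have hs : Summable fun n => ‖(F n).restrict
      (⟨Set.uIcc (0 : ℝ) 1, isCompact_uIcc⟩ : TopologicalSpace.Compacts ℝ)‖ := by
    refine Summable.of_nonneg_of_le (fun _ => norm_nonneg _) (fun n => ?_)
      ((summable_jacobiTheta₂_term_iff 0 τ).2 τ.im_pos).norm
    rw [ContinuousMap.norm_le _ (norm_nonneg _)]
    rintro ⟨x, hx⟩
    simp only [F, ContinuousMap.restrict_apply, ContinuousMap.coe_mk, norm_jacobiTheta₂_term]
    simp
  have hsum := intervalIntegral.hasSum_intervalIntegral_of_summable_norm hs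
  have hz : ∀ x : ℝ, ∑' n, F n x = 0 := fun x => h0 x
  simp only [hz, intervalIntegral.integral_zero] at hsum
  have hI : ∀ n : ℤ, (∫ x in (0 : ℝ)..1, F n x) = if n = 0 then 1 else 0 := by
    intro n
    simp only [F, ContinuousMap.coe_mk, hterm]
    split_ifs with hn
    · simp [hn]
    · have hc : (2 * Real.pi * I * n : ℂ) ≠ 0 :=
        mul_ne_zero Complex.two_pi_I_ne_zero (by exact_mod_cast hn)
      rw [intervalIntegral.integral_const_mul, integral_exp_mul_complex hc]
      have : cexp (2 * Real.pi * I * n * (1 : ℝ)) = 1 :=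
        Complex.exp_eq_one_iff.2 ⟨n, by push_cast; ring⟩
      rw [this]
      simp
  simp only [hI] at hsum
  have := hsum.unique (hasSum_ite_eq (0 : ℤ) (1 : ℂ))
  exact zero_ne_one this

lemma theta_one_one_eq_prod (τ : UpperHalfPlane) : ∃ c : ℂ, c ≠ 0 ∧
    ∀ z, theta 1 1 z τ = c * cexp (-(Real.pi * I * z)) * thetaProd τ z := by
  set R : ℂ → ℂ := fun z => cexp (Real.pi * I * z) * theta 1 1 z τ with hR
  have hRd : Differentiable ℂ R := by
    have := differentiable_theta 1 1 τ
    exact Differentiable.fun_mul (by fun_prop) this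
  have hPd := differentiable_thetaProd τ
  have hP1 : ∀ z, thetaProd τ z = 0 → deriv (thetaProd τ) z ≠ 0 := fun z hz => by
    obtain ⟨m, n, rfl⟩ := exists_of_thetaProd_eq_zero τ hz
    exact (thetaProd_simple τ m n).2
  have hR0 : ∀ z, thetaProd τ z = 0 → R z = 0 := fun z hz => by
    obtain ⟨m, n, rfl⟩ := exists_of_thetaProd_eq_zero τ hz
    simp [hR, theta_one_one_lattice]
  set h := quot R (thetaProd τ) with hh
  have hd : Differentiable ℂ h := differentiable_quot hRd hPd hR0 hP1
  have hmul : ∀ z, thetaProd τ z * h z = R z := mul_quot hR0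
  have hper1 : ∀ z, h (z + 1) = h z := by
    refine cancel_left hPd hP1 (hd.continuous.comp (by fun_prop)) hd.continuous fun z => ?_
    have hpi : cexp (Real.pi * I * (z + 1)) = -cexp (Real.pi * I * z) := by
      rw [mul_add, Complex.exp_add, mul_one, Complex.exp_pi_mul_I]; ring
    have := hmul (z + 1)
    rw [thetaProd_add_one] at this
    rw [this, hmul, hR]
    simp only [theta_add_one, hpi]
    ring
  have hperτ : ∀ z, h (z + τ) = h z := by
    refine cancel_left hPd hP1 (hd.continuous.comp (by fun_prop)) hd.continuous fun z => ?_
    have := hmul (z + τ)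
    rw [thetaProd_add_tau] at this
    refine mul_left_cancel₀ (neg_ne_zero.2 (Complex.exp_ne_zero (-(2 * Real.pi * I * z)))) ?_
    rw [← mul_assoc, this, hmul, hR]
    simp only [theta_add_tau]
    have e : cexp (Real.pi * I * (z + τ)) * cexp (-(Real.pi * I * (2 * z + τ))) =
        cexp (-(2 * Real.pi * I * z)) * cexp (Real.pi * I * z) := by
      rw [← Complex.exp_add, ← Complex.exp_add]; ring_nf
    linear_combination (-theta 1 1 z τ) * e
  have hlat : ∀ (z : ℂ) (m n : ℤ), h (z + (m + n * τ)) = h z := fun z m n => by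
    refine lattice_induction (p := fun w => h (z + w) = h z) (by simp) (fun w => ?_) (fun w => ?_) m n
    · rw [← add_assoc, hper1]
    · rw [← add_assoc, hperτ]
  have hτ0 : (τ : ℂ).im ≠ 0 := τ.im_pos.ne'
  have hbdd : Bornology.IsBounded (Set.range h) := by
    have hK : IsCompact ((fun p : ℝ × ℝ => h (p.1 + p.2 * τ)) ''
        (Set.Icc (0 : ℝ) 1 ×ˢ Set.Icc (0 : ℝ) 1)) := by
      refine (isCompact_Icc.prod isCompact_Icc).image (hd.continuous.comp ?_)
      fun_prop
    refine hK.isBounded.subset ?_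
    rintro _ ⟨z, rfl⟩
    set t : ℝ := z.im / (τ : ℂ).im with ht
    set s : ℝ := z.re - t * (τ : ℂ).re with hs
    have hz : z = s + t * τ := by
      apply Complex.ext
      · simp [hs]
      · simp only [Complex.add_im, Complex.mul_im, Complex.ofReal_im, Complex.ofReal_re, ht]
        field_simp
        ring
    refine ⟨(Int.fract s, Int.fract t), ⟨⟨Int.fract_nonneg _, (Int.fract_lt_one _).le⟩,
      ⟨Int.fract_nonneg _, (Int.fract_lt_one _).le⟩⟩, ?_⟩
    have e : z = ((Int.fract s : ℝ) + (Int.fract t : ℝ) * τ : ℂ) + (⌊s⌋ + ⌊t⌋ * τ) := by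
      have h1 : (s : ℂ) = ⌊s⌋ + (Int.fract s : ℝ) := by exact_mod_cast (Int.floor_add_fract s).symm
      have h2 : (t : ℂ) = ⌊t⌋ + (Int.fract t : ℝ) := by exact_mod_cast (Int.floor_add_fract t).symm
      rw [hz, h1, h2]
      ring
    rw [e, hlat]
  have hconst : ∀ z, h z = h 0 := fun z => hd.apply_eq_apply_of_bounded hbdd z 0
  have key : ∀ z, theta 1 1 z τ = h 0 * cexp (-(Real.pi * I * z)) * thetaProd τ z := fun z => by
    have h1 := hmul z
    have h2 : cexp (-(Real.pi * I * z)) * cexp (Real.pi * I * z) = 1 := by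
      rw [← Complex.exp_add]; simp
    rw [hconst, hR] at h1
    linear_combination (-theta 1 1 z τ) * h2 - cexp (-(Real.pi * I * z)) * h1
  refine ⟨h 0, fun h00 => ?_, key⟩
  obtain ⟨z, hz⟩ := exists_jacobiTheta₂_ne_zero τ
  have := key (z - 1 / 2 - 1 / 2 * τ)
  rw [h00, zero_mul, zero_mul, theta_eq] at this
  refine hz ((mul_eq_zero.1 this).resolve_left (Complex.exp_ne_zero _) ▸ ?_)
  congr 1
  push_cast
  ring

lemma theta_one_one_eq_zero {τ : UpperHalfPlane} {z : ℂ} (hz : theta 1 1 z τ = 0) :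
    ∃ m n : ℤ, z = m + n * τ := by
  obtain ⟨c, hc, h⟩ := theta_one_one_eq_prod τ
  rw [h, mul_eq_zero] at hz
  exact exists_of_thetaProd_eq_zero τ
    (hz.resolve_left (mul_ne_zero hc (Complex.exp_ne_zero _)))

lemma deriv_theta_one_one_ne_zero {τ : UpperHalfPlane} {z : ℂ} (hz : theta 1 1 z τ = 0) :
    deriv (fun w => theta 1 1 w τ) z ≠ 0 := by
  obtain ⟨m, n, rfl⟩ := theta_one_one_eq_zero hz
  obtain ⟨c, hc, h⟩ := theta_one_one_eq_prod τ
  obtain ⟨h0, h1⟩ := thetaProd_simple τ m n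
  rw [funext h, deriv_fun_mul (by fun_prop) (differentiable_thetaProd τ _), h0, mul_zero, zero_add]
  exact mul_ne_zero (mul_ne_zero hc (Complex.exp_ne_zero _)) h1

/-! ### Symbols `[z]`, `[z]_k`, `[z; a]_k` -/

/-- `[z] = θ₁₁(z, τ)`. -/
def bracket (τ : UpperHalfPlane) (z : ℂ) : ℂ := theta 1 1 z τ

/-- `[z]_k = [z][z + 2η] ⋯ [z + 2(k - 1)η]`. -/
def bracketPow (τ : UpperHalfPlane) (η : ℂ) (k : ℕ) (z : ℂ) : ℂ :=
  ∏ j ∈ Finset.range k, bracket τ (z + 2 * j * η)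

/-- `[z; a]_k = [z + a]_k [-z + a]_k`. -/
def bracketPair (τ : UpperHalfPlane) (η : ℂ) (k : ℕ) (z a : ℂ) : ℂ :=
  bracketPow τ η k (z + a) * bracketPow τ η k (-z + a)

lemma bracketPair_eq (τ : UpperHalfPlane) (η : ℂ) (k : ℕ) (z a : ℂ) : bracketPair τ η k z a =
    ∏ j ∈ Finset.range k,
      (theta 1 1 ((a + 2 * j * η) + z) τ * theta 1 1 ((a + 2 * j * η) - z) τ) := by
  rw [bracketPair, bracketPow, bracketPow, ← Finset.prod_mul_distrib]
  refine Finset.prod_congr rfl fun j _ => ?_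
  rw [bracket, bracket]
  ring_nf

lemma theta_pair_add_one (w z τ : ℂ) : theta 1 1 (w + (z + 1)) τ * theta 1 1 (w - (z + 1)) τ =
    theta 1 1 (w + z) τ * theta 1 1 (w - z) τ := by
  have h1 := theta_add_one 1 1 (w + z) τ
  have h2 := theta_add_one 1 1 (w - (z + 1)) τ
  rw [show w - (z + 1) + 1 = w - z by ring] at h2
  rw [← add_assoc, h1, h2]
  ring

lemma theta_pair_add_tau (w z τ : ℂ) : theta 1 1 (w + (z + τ)) τ * theta 1 1 (w - (z + τ)) τ =
    cexp (-(2 * Real.pi * I * (2 * z + τ))) * (theta 1 1 (w + z) τ * theta 1 1 (w - z) τ) := by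
  have h1 := theta_add_tau 1 1 (w + z) τ
  have h2 := theta_add_tau 1 1 (w - (z + τ)) τ
  rw [show w - (z + τ) + τ = w - z by ring] at h2
  have e : cexp (-(2 * Real.pi * I * (2 * z + τ))) *
      cexp (-(Real.pi * I * (2 * (w - (z + τ)) + τ))) =
      cexp (-(Real.pi * I * (2 * (w + z) + τ))) := by
    rw [← Complex.exp_add]; ring_nf
  rw [← add_assoc, h1, h2, ← e]
  ring

/-! ### The spin `l` representation of the Sklyanin algebra, with `d = 2 * l` -/

/-- The space `Θ₀₀^{4l+}` of even entire functions `f` with `f (z + 1) = f z` and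
`f (z + τ) = exp (-4 l π i (2 z + τ)) f z`, where `d = 2 l`. -/
def thetaSpace (τ : UpperHalfPlane) (d : ℕ) : Submodule ℂ (ℂ → ℂ) where
  carrier := {f | Differentiable ℂ f ∧ (∀ z, f (z + 1) = f z) ∧ (∀ z, f (-z) = f z) ∧
    ∀ z, f (z + τ) = cexp (-(2 * d * Real.pi * I * (2 * z + τ))) * f z}
  add_mem' := by
    rintro f g ⟨f0, f1, f2, f3⟩ ⟨g0, g1, g2, g3⟩
    refine ⟨f0.add g0, fun z => ?_, fun z => ?_, fun z => ?_⟩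
    · simp only [Pi.add_apply, f1, g1]
    · simp only [Pi.add_apply, f2, g2]
    · simp only [Pi.add_apply, f3, g3, mul_add]
  zero_mem' := ⟨differentiable_const 0, by simp, by simp, by simp⟩
  smul_mem' := by
    rintro c f ⟨f0, f1, f2, f3⟩
    refine ⟨f0.const_smul c, fun z => ?_, fun z => ?_, fun z => ?_⟩
    · simp only [Pi.smul_apply, f1]
    · simp only [Pi.smul_apply, f2]
    · simp only [Pi.smul_apply, f3, smul_eq_mul]; ring

/-- The spin `l = d / 2`. -/
def spin (d : ℕ) : ℂ := d / 2

/-- The theta functions `θ₁₁, θ₁₀, θ₀₀, θ₀₁`, numbered by `a = 0, 1, 2, 3`. -/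
def thetaIdx (τ : UpperHalfPlane) (a : Fin 4) (z : ℂ) : ℂ :=
  theta (![1, 1, 0, 0] a) (![1, 0, 0, 1] a) z τ

/-- `W_a^L(u)`. -/
def wL (τ : UpperHalfPlane) (η : ℂ) (a : Fin 4) (u : ℂ) : ℂ := thetaIdx τ a u / thetaIdx τ a η

/-- The functions `s_a(z)`; only `s₂` carries a factor `i`. -/
def sFun (τ : UpperHalfPlane) (η : ℂ) (a : Fin 4) (z : ℂ) : ℂ :=
  ![1, 1, I, 1] a * thetaIdx τ a η * thetaIdx τ a (2 * z)

/-- `s_a(z - lη) f(z + η) - s_a(-z - lη) f(z - η)`. -/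
def sklyaninNum (τ : UpperHalfPlane) (d : ℕ) (η : ℂ) (a : Fin 4) (f : ℂ → ℂ) (z : ℂ) : ℂ :=
  sFun τ η a (z - spin d * η) * f (z + η) - sFun τ η a (-z - spin d * η) * f (z - η)

lemma theta_add_two (a b : ℕ) (z τ : ℂ) : theta a b (z + 2) τ = theta a b z τ := by
  rw [show z + 2 = z + 1 + 1 by ring, theta_add_one, theta_add_one, ← mul_assoc, ← mul_pow]
  simp

lemma theta_add_two_tau (a b : ℕ) (z τ : ℂ) : theta a b (z + 2 * τ) τ =
    cexp (-(4 * Real.pi * I * (z + τ))) * theta a b z τ := by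
  rw [show z + 2 * τ = z + τ + τ by ring, theta_add_tau, theta_add_tau]
  have e : cexp (-(Real.pi * I * (2 * (z + τ) + τ))) * cexp (-(Real.pi * I * (2 * z + τ))) =
      cexp (-(4 * Real.pi * I * (z + τ))) := by
    rw [← Complex.exp_add]; ring_nf
  have e2 : ((-1 : ℂ) ^ b) * (-1) ^ b = 1 := by rw [← mul_pow]; simp
  rw [← e]
  linear_combination (cexp (-(Real.pi * I * (2 * (z + τ) + τ))) *
    cexp (-(Real.pi * I * (2 * z + τ))) * theta a b z τ) * e2

section numerator

variable {τ : UpperHalfPlane} {d : ℕ} {η : ℂ} {a : Fin 4} {f : ℂ → ℂ}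

lemma differentiable_thetaIdx : Differentiable ℂ (thetaIdx τ a) := differentiable_theta _ _ τ

lemma differentiable_sFun : Differentiable ℂ (sFun τ η a) := by
  have := (differentiable_thetaIdx (τ := τ) (a := a)).comp
    (f := fun z : ℂ => 2 * z) (by fun_prop)
  exact this.const_mul (![1, 1, I, 1] a * thetaIdx τ a η)

lemma sFun_add_one (z : ℂ) : sFun τ η a (z + 1) = sFun τ η a z := by
  rw [sFun, sFun, thetaIdx, thetaIdx, thetaIdx, mul_add, mul_one, theta_add_two]

lemma sFun_add_tau (z : ℂ) :
    sFun τ η a (z + τ) = cexp (-(4 * Real.pi * I * (2 * z + τ))) * sFun τ η a z := by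
  rw [sFun, sFun, thetaIdx, thetaIdx, thetaIdx, mul_add, theta_add_two_tau]
  ring

lemma sklyaninNum_neg (hf : f ∈ thetaSpace τ d) (z : ℂ) :
    sklyaninNum τ d η a f (-z) = -sklyaninNum τ d η a f z := by
  obtain ⟨-, -, f2, -⟩ := hf
  rw [sklyaninNum, sklyaninNum, neg_neg, show -z + η = -(z - η) by ring,
    show -z - η = -(z + η) by ring, f2, f2]
  ring

lemma sklyaninNum_add_one (hf : f ∈ thetaSpace τ d) (z : ℂ) :
    sklyaninNum τ d η a f (z + 1) = sklyaninNum τ d η a f z := by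
  obtain ⟨-, f1, -, -⟩ := hf
  have h : sFun τ η a (-(z + 1) - spin d * η) = sFun τ η a (-z - spin d * η) := by
    rw [← sFun_add_one]; ring_nf
  rw [sklyaninNum, sklyaninNum, h, show z + 1 - spin d * η = z - spin d * η + 1 by ring,
    sFun_add_one, show z + 1 + η = z + η + 1 by ring, show z + 1 - η = z - η + 1 by ring, f1, f1]

lemma sklyaninNum_add_tau (hf : f ∈ thetaSpace τ d) (z : ℂ) :
    sklyaninNum τ d η a f (z + τ) =
      cexp (-((2 * d + 4) * Real.pi * I * (2 * z + τ))) * sklyaninNum τ d η a f z := by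
  obtain ⟨-, -, -, f3⟩ := hf
  have h := sFun_add_tau (τ := τ) (η := η) (a := a) (-(z + τ) - spin d * η)
  rw [show -(z + τ) - spin d * η + τ = -z - spin d * η by ring] at h
  rw [sklyaninNum, sklyaninNum, h, show z + τ - spin d * η = z - spin d * η + τ by ring,
    sFun_add_tau, show z + τ + η = z + η + τ by ring, show z + τ - η = z - η + τ by ring, f3, f3]
  have e1 : cexp (-((2 * d + 4) * Real.pi * I * (2 * z + τ))) =
      cexp (-(4 * Real.pi * I * (2 * (z - spin d * η) + τ))) *
      cexp (-(2 * d * Real.pi * I * (2 * (z + η) + τ))) := by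
    rw [← Complex.exp_add, spin]; ring_nf
  have e2 : cexp (-((2 * d + 4) * Real.pi * I * (2 * z + τ))) *
      cexp (-(4 * Real.pi * I * (2 * (-(z + τ) - spin d * η) + τ))) =
      cexp (-(2 * d * Real.pi * I * (2 * (z - η) + τ))) := by
    rw [← Complex.exp_add, spin]; ring_nf
  linear_combination (-(sFun τ η a (z - spin d * η) * f (z + η))) * e1
    + (sFun τ η a (-(z + τ) - spin d * η) * f (z - η)) * e2

lemma differentiable_sklyaninNum (hf : f ∈ thetaSpace τ d) :
    Differentiable ℂ (sklyaninNum τ d η a f) := by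
  have hs := differentiable_sFun (τ := τ) (η := η) (a := a)
  have hf0 := hf.1
  exact ((hs.comp (by fun_prop)).fun_mul (hf0.comp (by fun_prop))).fun_sub
    ((hs.comp (by fun_prop)).fun_mul (hf0.comp (by fun_prop)))

lemma differentiable_theta_two : Differentiable ℂ fun z => theta 1 1 (2 * z) τ :=
  (differentiable_theta 1 1 τ).comp (f := fun z : ℂ => 2 * z) (by fun_prop)

lemma deriv_theta_two_ne_zero (z : ℂ) (hz : theta 1 1 (2 * z) τ = 0) :
    deriv (fun z => theta 1 1 (2 * z) τ) z ≠ 0 := by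
  have h := deriv_comp_mul_left (2 : ℂ) (fun w => theta 1 1 w τ) z
  rw [h, smul_eq_mul]
  exact mul_ne_zero two_ne_zero (deriv_theta_one_one_ne_zero hz)

lemma sklyaninNum_add_int_tau (hf : f ∈ thetaSpace τ d) (z : ℂ) (n : ℤ) :
    sklyaninNum τ d η a f (z + n * τ) =
      cexp (-((2 * d + 4) * Real.pi * I * (2 * n * z + n ^ 2 * τ))) *
        sklyaninNum τ d η a f z := by
  induction n with
  | zero => simp
  | succ k ih =>
    have h := sklyaninNum_add_tau (η := η) (a := a) hf (z + ((k : ℤ) : ℂ) * τ)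
    rw [ih, ← mul_assoc, ← Complex.exp_add] at h
    push_cast at h ⊢
    rw [show z + ((k : ℂ) + 1) * τ = z + k * τ + τ by ring, h]
    ring_nf
  | pred k ih =>
    have h := sklyaninNum_add_tau (η := η) (a := a) hf (z + ((-k - 1 : ℤ) : ℂ) * τ)
    rw [show z + ((-k - 1 : ℤ) : ℂ) * τ + τ = z + ((-k : ℤ) : ℂ) * τ by push_cast; ring, ih] at h
    refine mul_left_cancel₀ (Complex.exp_ne_zero _) (h.symm.trans ?_)
    rw [← mul_assoc, ← Complex.exp_add]
    push_cast
    ring_nf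

lemma sklyaninNum_add_int (hf : f ∈ thetaSpace τ d) (z : ℂ) (m : ℤ) :
    sklyaninNum τ d η a f (z + m) = sklyaninNum τ d η a f z := by
  have hp : Function.Periodic (sklyaninNum τ d η a f) 1 := sklyaninNum_add_one hf
  simpa using hp.int_mul m z

lemma sklyaninNum_eq_zero (hf : f ∈ thetaSpace τ d) (z : ℂ) (hz : theta 1 1 (2 * z) τ = 0) :
    sklyaninNum τ d η a f z = 0 := by
  obtain ⟨m, n, h⟩ := theta_one_one_eq_zero hz
  have h1 : z = -z + n * τ + m := by linear_combination h
  have h2 : sklyaninNum τ d η a f z = sklyaninNum τ d η a f (-z + n * τ + m) := by rw [← h1]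
  have h3 : cexp (-((2 * d + 4) * Real.pi * I * (2 * n * -z + n ^ 2 * τ))) = 1 := by
    rw [Complex.exp_eq_one_iff]
    refine ⟨(d + 2) * n * m, ?_⟩
    push_cast
    linear_combination ((2 * d + 4) * Real.pi * I * n) * h
  rw [sklyaninNum_add_int hf, sklyaninNum_add_int_tau hf, h3, one_mul, sklyaninNum_neg hf] at h2
  linear_combination h2 / 2

/-- The function `ρˡ(Sᵃ) f`: the difference operator `sklyaninNum` divided by `θ₁₁(2z, τ)`, where
the (removable) singularities at the zeros of `θ₁₁(2z, τ)` are filled in. -/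
def sklyaninFun (τ : UpperHalfPlane) (d : ℕ) (η : ℂ) (a : Fin 4) (f : ℂ → ℂ) : ℂ → ℂ :=
  quot (sklyaninNum τ d η a f) fun z => theta 1 1 (2 * z) τ

lemma theta_mul_sklyaninFun (hf : f ∈ thetaSpace τ d) (z : ℂ) :
    theta 1 1 (2 * z) τ * sklyaninFun τ d η a f z = sklyaninNum τ d η a f z :=
  mul_quot (g := fun z => theta 1 1 (2 * z) τ) (sklyaninNum_eq_zero hf) z

lemma differentiable_sklyaninFun (hf : f ∈ thetaSpace τ d) :
    Differentiable ℂ (sklyaninFun τ d η a f) :=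
  differentiable_quot (differentiable_sklyaninNum hf) differentiable_theta_two
    (sklyaninNum_eq_zero hf) deriv_theta_two_ne_zero

lemma theta_cancel {g h : ℂ → ℂ} (hg : Continuous g) (hh : Continuous h)
    (H : ∀ z, theta 1 1 (2 * z) τ * g z = theta 1 1 (2 * z) τ * h z) (z : ℂ) : g z = h z :=
  cancel_left differentiable_theta_two deriv_theta_two_ne_zero hg hh H z

lemma sklyaninFun_mem (hf : f ∈ thetaSpace τ d) : sklyaninFun τ d η a f ∈ thetaSpace τ d := by
  have hd := differentiable_sklyaninFun (η := η) (a := a) hf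
  have hm := theta_mul_sklyaninFun (η := η) (a := a) hf
  refine ⟨hd, ?_, ?_, ?_⟩
  · refine theta_cancel (τ := τ) (hd.continuous.comp (by fun_prop)) hd.continuous fun z => ?_
    have h := hm (z + 1)
    rw [mul_add, mul_one, theta_add_two, sklyaninNum_add_one hf] at h
    rw [h, hm]
  · refine theta_cancel (τ := τ) (hd.continuous.comp (by fun_prop)) hd.continuous fun z => ?_
    have h := hm (-z)
    rw [mul_neg, theta_one_one_neg, sklyaninNum_neg hf] at h
    rw [hm]
    linear_combination -h
  · refine theta_cancel (τ := τ) (hd.continuous.comp (by fun_prop))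
      (Continuous.mul (by fun_prop) hd.continuous) fun z => ?_
    have h := hm (z + τ)
    rw [mul_add, theta_add_two_tau, sklyaninNum_add_tau hf, ← hm] at h
    have e : cexp (-((2 * d + 4) * Real.pi * I * (2 * z + τ))) =
        cexp (-(4 * Real.pi * I * (2 * z + τ))) * cexp (-(2 * d * Real.pi * I * (2 * z + τ))) := by
      rw [← Complex.exp_add]; ring_nf
    rw [e] at h
    refine mul_left_cancel₀ (Complex.exp_ne_zero (-(4 * Real.pi * I * (2 * z + τ)))) ?_
    linear_combination h

end numerator

/-- The operator `ρˡ(Sᵃ)` on `Θ₀₀^{4l+}`, with `d = 2 l`. -/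
def rho (τ : UpperHalfPlane) (d : ℕ) (η : ℂ) (a : Fin 4) :
    thetaSpace τ d →ₗ[ℂ] thetaSpace τ d where
  toFun f := ⟨sklyaninFun τ d η a f, sklyaninFun_mem f.2⟩
  map_add' f g := by
    refine Subtype.ext (funext fun z => ?_)
    refine theta_cancel (τ := τ) (differentiable_sklyaninFun (f + g).2).continuous
      ((differentiable_sklyaninFun f.2).continuous.add
        (differentiable_sklyaninFun g.2).continuous) (fun z => ?_) z
    rw [theta_mul_sklyaninFun (f + g).2, Pi.add_apply, mul_add, theta_mul_sklyaninFun f.2,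
      theta_mul_sklyaninFun g.2]
    simp only [sklyaninNum, Submodule.coe_add, Pi.add_apply]
    ring
  map_smul' c f := by
    refine Subtype.ext (funext fun z => ?_)
    refine theta_cancel (τ := τ) (differentiable_sklyaninFun (c • f).2).continuous
      ((differentiable_sklyaninFun f.2).continuous.const_smul c) (fun z => ?_) z
    rw [theta_mul_sklyaninFun (c • f).2, Pi.smul_apply, smul_eq_mul, mul_left_comm, theta_mul_sklyaninFun f.2]
    simp only [sklyaninNum, SetLike.val_smul, Pi.smul_apply, smul_eq_mul]
    ring

/-- Away from the zeros of `θ₁₁(2z, τ)`, `rho` is given by the familiar difference operator. -/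
lemma rho_apply (τ : UpperHalfPlane) (d : ℕ) (η : ℂ) (a : Fin 4) (f : thetaSpace τ d) (z : ℂ)
    (hz : theta 1 1 (2 * z) τ ≠ 0) : (rho τ d η a f : ℂ → ℂ) z =
      (sFun τ η a (z - spin d * η) * (f : ℂ → ℂ) (z + η)
        - sFun τ η a (-z - spin d * η) * (f : ℂ → ℂ) (z - η)) / theta 1 1 (2 * z) τ :=
  if_neg hz

/-! ### The transfer matrix -/

/-- The Pauli matrices `σ⁰, σ¹, σ², σ³`. -/
def pauli : Fin 4 → Matrix (Fin 2) (Fin 2) ℂ :=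
  ![!![1, 0; 0, 1], !![0, 1; 1, 0], !![0, -I; I, 0], !![1, 0; 0, -1]]

/-- The Hilbert space `V_N ⊗ ⋯ ⊗ V_1`, all `V_n = Θ₀₀^{4l+}`. Site `n + 1` is the index `n`. -/
abbrev StateSpace (N : ℕ) (τ : UpperHalfPlane) (d : ℕ) : Type :=
  PiTensorProduct ℂ fun _ : Fin N => thetaSpace τ d

/-- The operator `1 ⊗ ⋯ ⊗ A ⊗ ⋯ ⊗ 1` acting by `A` on the tensor factor `n`. -/
def siteOp {N : ℕ} {τ : UpperHalfPlane} {d : ℕ} (n : Fin N)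
    (A : thetaSpace τ d →ₗ[ℂ] thetaSpace τ d) : Module.End ℂ (StateSpace N τ d) :=
  PiTensorProduct.map (Function.update (fun _ => LinearMap.id) n A)

/-- The `L`-operator `L_n(u) = ∑ₐ W_a^L(u) ρ_n(Sᵃ) ⊗ σᵃ`, as a `2 × 2` matrix of operators on the
Hilbert space. -/
def lOp (N : ℕ) (τ : UpperHalfPlane) (d : ℕ) (η : ℂ) (n : Fin N) (u : ℂ) :
    Matrix (Fin 2) (Fin 2) (Module.End ℂ (StateSpace N τ d)) :=
  fun i j => ∑ a : Fin 4, (wL τ η a u * pauli a i j) • siteOp n (rho τ d η a)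

/-- The transfer matrix `T(u) = tr₀ L_N(u) ⋯ L_1(u)`. -/
def transfer (N : ℕ) (τ : UpperHalfPlane) (d : ℕ) (η : ℂ) (u : ℂ) :
    Module.End ℂ (StateSpace N τ d) :=
  Matrix.trace (List.ofFn fun n : Fin N => lOp N τ d η n.rev u).prod

/-! ### The operator `Q_R` -/

/-- The vector `f_ε(λ, u, z) = [z; (ελ + u)/2 + (-l + 1)η]_{2l}` for `ε = ±1`, as an element of
`Θ₀₀^{4l+}`. -/
def nullVec (τ : UpperHalfPlane) (d : ℕ) (η : ℂ) (ε : ℤˣ) (lam u : ℂ) : thetaSpace τ d :=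
  ⟨fun z => bracketPair τ η d z (((ε : ℤ) * lam + u) / 2 + (-spin d + 1) * η), by
    refine ⟨?_, fun z => ?_, fun z => ?_, fun z => ?_⟩
    · have h := differentiable_theta 1 1 τ
      simp only [bracketPair_eq]
      refine Differentiable.fun_finsetProd fun j _ => ?_
      exact (h.comp (by fun_prop)).fun_mul (h.comp (by fun_prop))
    · simp only [bracketPair_eq, theta_pair_add_one]
    · simp only [bracketPair, neg_neg]
      rw [mul_comm]
    · simp only [bracketPair_eq, theta_pair_add_tau]
      rw [Finset.prod_mul_distrib, Finset.prod_const, Finset.card_range, ← Complex.exp_nat_mul]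
      ring_nf⟩

/-- The matrix `S(u)` of operators `ℂᵐ → Θ₀₀^{4l+}` with parameters `t k j`. In the column
`j'' = j + 1`, with `λ = 2 (2 j'' - 1) l η`, the entry `S^{i''}_{j''}(u)` sends the basis vector
`e_k` to `t k j • f₊(λ, u, z)` if `i'' = j'' + 1` or `i'' = j'' = r`, to `t k j • f₋(λ, u, z)` if
`i'' = j'' - 1` or `i'' = j'' = 1`, and to `0` otherwise. (For `r = 1` the two cases collide.) -/
def sMat {m r : ℕ} (τ : UpperHalfPlane) (d : ℕ) (η : ℂ) (t : Fin m → Fin r → ℂ) (u : ℂ) :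
    Matrix (Fin r) (Fin r) ((Fin m → ℂ) →ₗ[ℂ] thetaSpace τ d) := fun i j =>
  let lam : ℂ := 2 * (2 * ((j : ℂ) + 1) - 1) * spin d * η
  let coeff : (Fin m → ℂ) →ₗ[ℂ] ℂ := ∑ k : Fin m, t k j • LinearMap.proj k
  if (i : ℕ) = j + 1 ∨ (i = j ∧ (j : ℕ) + 1 = r) then coeff.smulRight (nullVec τ d η 1 lam u)
  else if (i : ℕ) + 1 = j ∨ (i = j ∧ (j : ℕ) = 0) then coeff.smulRight (nullVec τ d η (-1) lam u)
  else 0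

/-- `Q_R(u) = tr S_N(u) ⋯ S_1(u)`, the trace being taken over `ℂʳ` and `S_n(u)` acting on the tensor
factor `n`, so that
`Q_R(u) = ∑ S^{i_N}_{i_{N-1}}(u) ⊗ S^{i_{N-1}}_{i_{N-2}}(u) ⊗ ⋯ ⊗ S^{i_1}_{i_N}(u)`, summed over
`i_1, …, i_N ∈ {1, …, r}`. (The subtraction `n - 1` in `Fin N` is cyclic.) -/
def qR (N : ℕ) [NeZero N] {m r : ℕ} (τ : UpperHalfPlane) (d : ℕ) (η : ℂ) (t : Fin m → Fin r → ℂ)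
    (u : ℂ) : (PiTensorProduct ℂ fun _ : Fin N => Fin m → ℂ) →ₗ[ℂ] StateSpace N τ d :=
  ∑ p : Fin N → Fin r, PiTensorProduct.map fun n => sMat τ d η t u (p n) (p (n - 1))

/-- `h_ε(u) = (2 [u - 2 ε l η])^N` for `ε = ±1`. -/
def hFun (N : ℕ) (τ : UpperHalfPlane) (d : ℕ) (η : ℂ) (ε : ℤˣ) (u : ℂ) : ℂ :=
  (2 * bracket τ (u - (ε : ℤ) * (2 * spin d * η))) ^ N

end EightVertex

end

open EightVertex

/-!
Baxter's relation holds because, in a suitable gauge, every local factor `L_n(u) S_n(u)` is upper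
triangular with diagonal entries `2[u + 2lη] S_n(u - 2η)` and `2[u - 2lη] S_n(u + 2η)`.

*Rank one.* Let `A(x) = θ₀₀(x, τ/2)` and `B(x) = A(x + 1/2)`, both even with period 1, and put
`v(q) = (A(q), -B(q))`, `w(p) = (B(p), A(p))`. Riemann's addition formula gives
`∑ₐ c_a ϑ_a(u) ϑ_a(2x) σᵃ = v(u/2 - x) w(u/2 + x)ᵗ` (`sum_thetaIdx_pauli`), and its trace is
`w(p) · v(q) = 2[p + q][p - q]` (`gaugeRow_dotProduct_gaugeCol`). Hence `w(q)` annihilates `v(q)`,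
and the Plücker relation among three vectors of `ℂ²` becomes a three-term relation for brackets
(`gaugeCol_three_term`, `gaugeRow_three_term`).

*Local triangularity.* Applied to the null vector `f_ε(λ, u, ·)`, the `L`-operator contracted with
`v(λ/2)` is `2[u + 2lη] f_ε(λ, u - 2η, ·)` times `v(λ/2 + 2εlη)` (`localL_nullVec_gaugeCol`), and
contracted from the left with `w(λ/2 + 2εlη)` it is `2[u - 2lη] f_ε(λ, u + 2η, ·)` times `w(λ/2)`
(`localL_nullVec_gaugeRow`). Both follow from telescoping of the products in `f_ε` and one
three-term relation.

*Closing up.* Attach `v(λ_i/2)` to the index `i` of the auxiliary space. A nonzero entry `S^i_j`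
shifts `λ_j/2` by `±2lη`, which is `λ_i/2` for neighbouring `i` and `j`; at the ends of the chain it
is `-λ_i/2` up to an integer, because `2lrη ∈ ℤ`, and the gauge vectors are even and periodic
(`sMat_cases`). So along each closed path contributing to `Q_R` the monodromy matrix has the
eigenvector `v` and its annihilator `w` as a left eigenvector (`monodromy_transport_col`,
`monodromy_transport_row`), and its trace is the sum of the two eigenvalues
(`add_eq_of_eigenvectors`).
-/

noncomputable section

namespace EightVertex

/-! ### Factorization of theta products at modulus `τ / 2` -/

/-- The theta function `θ₀₀(x, τ/2)`. -/
def halfTheta (τ : UpperHalfPlane) (x : ℂ) : ℂ := jacobiTheta₂ x ((τ : ℂ) / 2)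

lemma halfTheta_neg (τ : UpperHalfPlane) (x : ℂ) : halfTheta τ (-x) = halfTheta τ x :=
  jacobiTheta₂_neg_left _ _

lemma halfTheta_add_one (τ : UpperHalfPlane) (x : ℂ) : halfTheta τ (x + 1) = halfTheta τ x :=
  jacobiTheta₂_add_left _ _

lemma hasSum_theta (a b : ℕ) (z : ℂ) (τ : UpperHalfPlane) :
    HasSum (fun n : ℤ => cexp (Real.pi * I * ((a : ℂ) / 2 + n) ^ 2 * τ
      + 2 * Real.pi * I * ((a : ℂ) / 2 + n) * ((b : ℂ) / 2 + z))) (theta a b z τ) := by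
  rw [theta_eq]
  refine ((hasSum_jacobiTheta₂_term _ τ.im_pos).mul_left _).congr_fun fun n => ?_
  rw [jacobiTheta₂_term, ← Complex.exp_add]
  congr 1
  ring

/-- The pairs of integers with even sum and those with odd sum, parametrized by half-sum and
half-difference. -/
lemma isCompl_range_parity :
    IsCompl (Set.range fun p : ℤ × ℤ => (p.1 + p.2, p.1 - p.2))
      (Set.range fun p : ℤ × ℤ => (p.1 + p.2 + 1, p.1 - p.2)) := by
  refine ⟨Set.disjoint_left.2 ?_, codisjoint_iff.2 (Set.eq_univ_iff_forall.2 ?_)⟩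
  · rintro _ ⟨⟨a, b⟩, rfl⟩ ⟨⟨c, d⟩, h⟩
    simp only [Prod.mk.injEq] at h
    omega
  · rintro ⟨a, b⟩
    rcases Int.even_or_odd (a + b) with ⟨k, hk⟩ | ⟨k, hk⟩
    · exact Or.inl ⟨(k, k - b), by simp only [Prod.mk.injEq]; omega⟩
    · exact Or.inr ⟨(k, k - b), by simp only [Prod.mk.injEq]; omega⟩

/-- Both products on the left are sums over the lattices `ℤ²` and `(ℤ + 1/2)²`; the rotation
`(m, n) ↦ (m + n, m - n)` maps their union bijectively to `ℤ²`. -/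
lemma theta_mul_add_theta_mul (τ : UpperHalfPlane) (x y : ℂ) :
    theta 0 0 x τ * theta 0 0 y τ + theta 1 0 x τ * theta 1 0 y τ =
      halfTheta τ ((x + y) / 2) * halfTheta τ ((x - y) / 2) := by
  have hτ2 : 0 < ((τ : ℂ) / 2).im := by
    have := τ.im_pos
    simpa using this
  have hmul : ∀ {f g : ℤ → ℂ} {s t : ℂ}, HasSum f s → HasSum g t →
      HasSum (fun p : ℤ × ℤ => f p.1 * g p.2) (s * t) := fun hf hg =>
    hf.mul hg (summable_mul_of_summable_norm hf.summable.norm hg.summable.norm)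
  have hR := hmul (hasSum_jacobiTheta₂_term ((x + y) / 2) hτ2)
    (hasSum_jacobiTheta₂_term ((x - y) / 2) hτ2)
  have h0 := hmul (hasSum_theta 0 0 x τ) (hasSum_theta 0 0 y τ)
  have h1 := hmul (hasSum_theta 1 0 x τ) (hasSum_theta 1 0 y τ)
  have i0 : Function.Injective fun p : ℤ × ℤ => (p.1 + p.2, p.1 - p.2) := by
    rintro ⟨a, b⟩ ⟨c, d⟩ h
    simp only [Prod.mk.injEq] at h ⊢
    omega
  have i1 : Function.Injective fun p : ℤ × ℤ => (p.1 + p.2 + 1, p.1 - p.2) := by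
    rintro ⟨a, b⟩ ⟨c, d⟩ h
    simp only [Prod.mk.injEq] at h ⊢
    omega
  refine HasSum.unique (HasSum.add_isCompl isCompl_range_parity
    (i0.hasSum_range_iff.2 (h0.congr_fun fun p => ?_))
    (i1.hasSum_range_iff.2 (h1.congr_fun fun p => ?_))) hR
  · rw [Function.comp_apply, jacobiTheta₂_term, jacobiTheta₂_term, ← Complex.exp_add, ← Complex.exp_add]
    congr 1
    push_cast
    ring
  · rw [Function.comp_apply, jacobiTheta₂_term, jacobiTheta₂_term, ← Complex.exp_add, ← Complex.exp_add]
    congr 1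
    push_cast
    ring

lemma theta_one_right (a : ℕ) (z τ : ℂ) : theta a 1 z τ = theta a 0 (z + 1 / 2) τ := by
  rw [theta, theta]
  refine tsum_congr fun n => ?_
  congr 1
  push_cast
  ring

/-- The column vectors `v(q)` of the rank one factorization. They also serve as gauge vectors. -/
def gaugeCol (τ : UpperHalfPlane) (q : ℂ) : Fin 2 → ℂ :=
  ![halfTheta τ q, -halfTheta τ (q + 1 / 2)]

/-- The row vectors `w(p)` of the rank one factorization; `w(p)` annihilates `v(p)`. -/
def gaugeRow (τ : UpperHalfPlane) (p : ℂ) : Fin 2 → ℂ :=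
  ![halfTheta τ (p + 1 / 2), halfTheta τ p]

lemma halfTheta_neg_add_half (τ : UpperHalfPlane) (x : ℂ) :
    halfTheta τ (-x + 1 / 2) = halfTheta τ (x + 1 / 2) := by
  rw [← halfTheta_neg, ← halfTheta_add_one]
  ring_nf

lemma gaugeCol_neg (τ : UpperHalfPlane) (x : ℂ) : gaugeCol τ (-x) = gaugeCol τ x := by
  rw [gaugeCol, gaugeCol, halfTheta_neg, halfTheta_neg_add_half]

lemma gaugeRow_neg (τ : UpperHalfPlane) (x : ℂ) : gaugeRow τ (-x) = gaugeRow τ x := by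
  rw [gaugeRow, gaugeRow, halfTheta_neg, halfTheta_neg_add_half]

lemma halfTheta_add_int (τ : UpperHalfPlane) (x : ℂ) (n : ℤ) :
    halfTheta τ (x + n) = halfTheta τ x := by
  have hp : Function.Periodic (halfTheta τ) 1 := halfTheta_add_one τ
  simpa using hp.int_mul n x

lemma gaugeCol_add_int (τ : UpperHalfPlane) (x : ℂ) (n : ℤ) :
    gaugeCol τ (x + n) = gaugeCol τ x := by
  rw [gaugeCol, gaugeCol, halfTheta_add_int, show x + n + 1 / 2 = x + 1 / 2 + n by ring,
    halfTheta_add_int]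

lemma gaugeRow_add_int (τ : UpperHalfPlane) (x : ℂ) (n : ℤ) :
    gaugeRow τ (x + n) = gaugeRow τ x := by
  rw [gaugeRow, gaugeRow, halfTheta_add_int, show x + n + 1 / 2 = x + 1 / 2 + n by ring,
    halfTheta_add_int]

/-- The matrix `∑ₐ c_a ϑ_a(u) ϑ_a(2w) σᵃ`, from which the `L`-operator is built, has rank one. -/
lemma sum_thetaIdx_pauli (τ : UpperHalfPlane) (u w : ℂ) (i j : Fin 2) :
    ∑ a : Fin 4, ![1, 1, I, 1] a * thetaIdx τ a u * thetaIdx τ a (2 * w) * pauli a i j =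
      gaugeCol τ (u / 2 - w) i * gaugeRow τ (u / 2 + w) j := by
  have e00 := theta_mul_add_theta_mul τ u (2 * w)
  have e01 := theta_mul_add_theta_mul τ (u + 1) (2 * w)
  have e10 := theta_mul_add_theta_mul τ (u + 1 / 2) (2 * w + 1 / 2)
  have e11 := theta_mul_add_theta_mul τ (u + 1 / 2) (2 * w + 1 / 2 - 1)
  have p0 := theta_add_one 0 0 (2 * w + 1 / 2 - 1) τ
  have p1 := theta_add_one 1 0 (2 * w + 1 / 2 - 1) τ
  rw [sub_add_cancel] at p0 p1
  rw [theta_add_one, theta_add_one] at e01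
  rw [show (u + 2 * w) / 2 = u / 2 + w by ring, show (u - 2 * w) / 2 = u / 2 - w by ring] at e00
  rw [show (u + 1 + 2 * w) / 2 = u / 2 + w + 1 / 2 by ring,
    show (u + 1 - 2 * w) / 2 = u / 2 - w + 1 / 2 by ring] at e01
  rw [show (u + 1 / 2 + (2 * w + 1 / 2)) / 2 = u / 2 + w + 1 / 2 by ring,
    show (u + 1 / 2 - (2 * w + 1 / 2)) / 2 = u / 2 - w by ring] at e10
  rw [show (u + 1 / 2 + (2 * w + 1 / 2 - 1)) / 2 = u / 2 + w by ring,
    show (u + 1 / 2 - (2 * w + 1 / 2 - 1)) / 2 = u / 2 - w + 1 / 2 by ring] at e11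
  simp only [pow_zero, pow_one, one_mul] at p0 p1 e01
  have hI : I * I = -1 := Complex.I_mul_I
  fin_cases i <;> fin_cases j <;>
    simp [Fin.sum_univ_four, thetaIdx, pauli, gaugeCol, gaugeRow, theta_one_right] <;>
    simp only [one_div] at e00 e01 e10 e11 p0 p1
  · linear_combination e10
  · linear_combination e00 - theta 0 0 u τ * theta 0 0 (2 * w) τ * hI
  · linear_combination -e01 + theta 0 0 u τ * theta 0 0 (2 * w) τ * hI
  · rw [p0, p1]
    linear_combination -e11

/-- The trace of the rank one factorization: only the coefficient of `σ⁰` survives. -/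
lemma gaugeRow_dotProduct_gaugeCol (τ : UpperHalfPlane) (p q : ℂ) :
    ∑ a, gaugeRow τ p a * gaugeCol τ q a = 2 * bracket τ (p + q) * bracket τ (p - q) := by
  have h0 := sum_thetaIdx_pauli τ (p + q) ((p - q) / 2) 0 0
  have h1 := sum_thetaIdx_pauli τ (p + q) ((p - q) / 2) 1 1
  rw [show (p + q) / 2 - (p - q) / 2 = q by ring, show (p + q) / 2 + (p - q) / 2 = p by ring,
    show 2 * ((p - q) / 2) = p - q by ring] at h0 h1
  simp only [Fin.sum_univ_four, pauli] at h0 h1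
  simp [thetaIdx] at h0 h1
  rw [Fin.sum_univ_two, bracket, bracket]
  linear_combination -h0 - h1

/-- The three-term relation for the vectors `v`, an instance of the Plücker relation in `ℂ²`. -/
lemma gaugeCol_three_term (τ : UpperHalfPlane) (p q s : ℂ) (a : Fin 2) :
    gaugeCol τ p a * (bracket τ (q + s) * bracket τ (q - s)) -
      gaugeCol τ q a * (bracket τ (p + s) * bracket τ (p - s)) =
      gaugeCol τ s a * (bracket τ (q + p) * bracket τ (q - p)) := by
  have h1 := gaugeRow_dotProduct_gaugeCol τ q s
  have h2 := gaugeRow_dotProduct_gaugeCol τ p s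
  have h3 := gaugeRow_dotProduct_gaugeCol τ q p
  fin_cases a <;> simp [gaugeRow, gaugeCol] at h1 h2 h3 ⊢
  · linear_combination (-halfTheta τ p * h1 + halfTheta τ q * h2 + halfTheta τ s * h3) / 2
  · linear_combination (halfTheta τ (p + 2⁻¹) * h1 - halfTheta τ (q + 2⁻¹) * h2
      - halfTheta τ (s + 2⁻¹) * h3) / 2

/-- The three-term relation for the annihilators `w`. -/
lemma gaugeRow_three_term (τ : UpperHalfPlane) (p q s : ℂ) (a : Fin 2) :
    gaugeRow τ p a * (bracket τ (q + s) * bracket τ (q - s)) -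
      gaugeRow τ q a * (bracket τ (p + s) * bracket τ (p - s)) =
      gaugeRow τ s a * (bracket τ (q + p) * bracket τ (q - p)) := by
  have h1 := gaugeRow_dotProduct_gaugeCol τ q s
  have h2 := gaugeRow_dotProduct_gaugeCol τ p s
  have h3 := gaugeRow_dotProduct_gaugeCol τ q p
  fin_cases a <;> simp [gaugeRow, gaugeCol] at h1 h2 h3 ⊢
  · linear_combination (-halfTheta τ (p + 2⁻¹) * h1 + halfTheta τ (q + 2⁻¹) * h2
      + halfTheta τ (s + 2⁻¹) * h3) / 2
  · linear_combination (-halfTheta τ p * h1 + halfTheta τ q * h2 + halfTheta τ s * h3) / 2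

/-- If `w(p)` vanished, so would the product `[2p + s][s]` for every `s`. -/
lemma gaugeRow_ne_zero (τ : UpperHalfPlane) (p : ℂ) : gaugeRow τ p ≠ 0 := by
  intro h
  have hz : ∀ s : ℂ, bracket τ (2 * p + s) * bracket τ s = 0 := fun s => by
    have h2 := gaugeRow_dotProduct_gaugeCol τ p (p + s)
    simp only [h, Pi.zero_apply, zero_mul, Finset.sum_const_zero] at h2
    have hneg : bracket τ (p - (p + s)) = -bracket τ s := by
      rw [bracket, bracket, ← theta_one_one_neg]
      ring_nf
    rw [hneg, show p + (p + s) = 2 * p + s by ring] at h2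
    linear_combination h2 / 2
  -- Close to `s = 0`, but away from it, both factors are nonzero.
  have hd := differentiable_theta 1 1 τ
  have hd2 : Differentiable ℂ fun s => theta 1 1 (2 * p + s) τ := hd.comp (by fun_prop)
  have e1 := eventually_ne_of_simple hd (fun z hz => deriv_theta_one_one_ne_zero hz) 0
  have e2 := eventually_ne_of_simple hd2 (fun z hz => by
    rw [deriv_comp_const_add (f := fun w => theta 1 1 w τ)]
    exact deriv_theta_one_one_ne_zero hz) 0
  obtain ⟨s, h1, h2⟩ := (e1.and e2).exists
  exact mul_ne_zero h2 h1 (hz s)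

/-! ### Nonvanishing of the normalizing theta constants -/

lemma theta_one_one_eq_zero_of_theta_eq_zero {a b : ℕ} {z τ : ℂ} (h : theta a b z τ = 0) :
    theta 1 1 (z + ((b : ℂ) - 1) / 2 + ((a : ℂ) - 1) / 2 * τ) τ = 0 := by
  rw [theta_eq, mul_eq_zero] at h ⊢
  refine Or.inr ?_
  rw [← h.resolve_left (Complex.exp_ne_zero _)]
  congr 1
  push_cast
  ring

/-- The weights `W_a(u) = ϑ_a(u) / ϑ_a(η)` have nonzero denominators, since the zeros of the four
theta functions are the translates of the lattice by its half-periods, and none of those is real, nonzero and of absolute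
value less than `1/2`. -/
lemma thetaIdx_ne_zero (τ : UpperHalfPlane) (a : Fin 4) {η : ℝ} (h0 : η ≠ 0)
    (h1 : |η| < 1 / 2) : thetaIdx τ a η ≠ 0 := by
  intro h
  obtain ⟨m, n, hmn⟩ := theta_one_one_eq_zero (theta_one_one_eq_zero_of_theta_eq_zero h)
  have hre := congrArg Complex.re hmn
  have him := congrArg Complex.im hmn
  have hτ : 0 < (τ : ℂ).im := τ.im_pos
  rw [abs_lt] at h1
  have half_int : ∀ k : ℤ, (-1 / 2 : ℝ) ≠ k := fun k hk => by
    have : ((-1 : ℤ) : ℝ) = ((2 * k : ℤ) : ℝ) := by push_cast; linarith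
    have := Int.cast_injective this
    omega
  fin_cases a <;> simp at hre him
  · rcases him with rfl | him
    · have h2 : η = m := by simpa using hre
      have h3 : ((-1 : ℤ) : ℝ) < m := by push_cast; linarith [h1.1]
      have h4 : (m : ℝ) < ((1 : ℤ) : ℝ) := by push_cast; linarith [h1.2]
      have h5 : m = 0 := by
        have := Int.cast_lt.1 h3
        have := Int.cast_lt.1 h4
        omega
      exact h0 (by rw [h2, h5, Int.cast_zero])
    · exact hτ.ne' him
  · rcases him with rfl | him
    · have h2 : η + -1 / 2 = m := by simpa using hre
      have h3 : ((-1 : ℤ) : ℝ) < m := by push_cast; linarith [h1.1]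
      have h4 : (m : ℝ) < ((0 : ℤ) : ℝ) := by push_cast; linarith [h1.2]
      have := Int.cast_lt.1 h3
      have := Int.cast_lt.1 h4
      omega
    · exact hτ.ne' him
  · exact him.elim (half_int n) hτ.ne'
  · exact him.elim (half_int n) hτ.ne'

/-! ### The local `L`-operator in the gauge basis -/

/-- The entries of the `L`-operator `∑ₐ W_a(u) ρˡ(Sᵃ) ⊗ σᵃ` on a single tensor factor. -/
def localL (τ : UpperHalfPlane) (d : ℕ) (η u : ℂ) (i j : Fin 2) :
    Module.End ℂ (thetaSpace τ d) :=
  ∑ a : Fin 4, (wL τ η a u * pauli a i j) • rho τ d η a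

/-- The rank one form of the `L`-operator as a difference operator. -/
lemma theta_mul_localL {τ : UpperHalfPlane} {d : ℕ} {η : ℂ} (hW : ∀ a, thetaIdx τ a η ≠ 0)
    (u : ℂ) (i j : Fin 2) (f : thetaSpace τ d) (z : ℂ) :
    theta 1 1 (2 * z) τ * (localL τ d η u i j f : ℂ → ℂ) z =
      gaugeCol τ (u / 2 - z + spin d * η) i * gaugeRow τ (u / 2 + z - spin d * η) j *
        (f : ℂ → ℂ) (z + η) -
      gaugeCol τ (u / 2 + z + spin d * η) i * gaugeRow τ (u / 2 - z - spin d * η) j *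
        (f : ℂ → ℂ) (z - η) := by
  have h1 := sum_thetaIdx_pauli τ u (z - spin d * η) i j
  have h2 := sum_thetaIdx_pauli τ u (-z - spin d * η) i j
  rw [show u / 2 - (z - spin d * η) = u / 2 - z + spin d * η by ring, ← add_sub_assoc] at h1
  rw [show u / 2 - (-z - spin d * η) = u / 2 + z + spin d * η by ring, ← add_sub_assoc,
    ← sub_eq_add_neg] at h2
  have hterm : ∀ a : Fin 4, theta 1 1 (2 * z) τ *
      (wL τ η a u * pauli a i j * (rho τ d η a f : ℂ → ℂ) z) =
      ![1, 1, I, 1] a * thetaIdx τ a u * thetaIdx τ a (2 * (z - spin d * η)) * pauli a i j *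
        (f : ℂ → ℂ) (z + η) -
      ![1, 1, I, 1] a * thetaIdx τ a u * thetaIdx τ a (2 * (-z - spin d * η)) * pauli a i j *
        (f : ℂ → ℂ) (z - η) := fun a => by
    have e := theta_mul_sklyaninFun (η := η) (a := a) f.2 z
    have hWa := hW a
    rw [mul_left_comm]
    change wL τ η a u * pauli a i j * (theta 1 1 (2 * z) τ * sklyaninFun τ d η a f z) = _
    rw [e, sklyaninNum, sFun, sFun, wL]
    field_simp
  rw [← h1, ← h2, Finset.sum_mul, Finset.sum_mul, ← Finset.sum_sub_distrib]
  simp only [← hterm, ← Finset.mul_sum]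
  simp [localL, LinearMap.sum_apply]

lemma nullVec_apply (τ : UpperHalfPlane) (d : ℕ) (η : ℂ) (ε : ℤˣ) (lam u z : ℂ) :
    (nullVec τ d η ε lam u : ℂ → ℂ) z =
      bracketPair τ η d z (((ε : ℤ) * lam + u) / 2 + (-spin d + 1) * η) := rfl

/-- Both sides are `[w]_{k+1}`. -/
lemma bracketPow_mul_bracket (τ : UpperHalfPlane) (η : ℂ) (k : ℕ) (w : ℂ) :
    bracketPow τ η k w * bracket τ (w + 2 * k * η) =
      bracket τ w * bracketPow τ η k (w + 2 * η) := by
  rw [bracketPow, ← Finset.prod_range_succ (fun j : ℕ => bracket τ (w + 2 * j * η)),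
    Finset.prod_range_succ', bracketPow, mul_comm]
  congr 1
  · simp
  · refine Finset.prod_congr rfl fun j _ => ?_
    congr 1
    push_cast
    ring

/-- Shifting `z` by `η` in `[z; a]_k` changes it to `[z; a - η]_k` up to the outermost factors. -/
lemma bracket_mul_bracketPair_add (τ : UpperHalfPlane) (η : ℂ) (k : ℕ) (z a : ℂ) :
    bracket τ (a - η + z) * bracketPair τ η k (z + η) a =
      bracket τ (a + (2 * k - 1) * η + z) * bracketPair τ η k z (a - η) := by
  have h := bracketPow_mul_bracket τ η k (z + (a - η))
  rw [show z + (a - η) + 2 * η = z + η + a by ring, show z + (a - η) = a - η + z by ring,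
    show a - η + z + 2 * k * η = a + (2 * k - 1) * η + z by ring] at h
  rw [bracketPair, bracketPair, show z + (a - η) = a - η + z by ring,
    show -(z + η) + a = -z + (a - η) by ring]
  linear_combination (-bracketPow τ η k (-z + (a - η))) * h

/-- Shifting `z` by `η` in `[z; a]_k` also changes it to `[z; a + η]_k` up to factors. -/
lemma bracket_mul_bracketPair_sub (τ : UpperHalfPlane) (η : ℂ) (k : ℕ) (z a : ℂ) :
    bracket τ (a + (2 * k - 1) * η - z) * bracketPair τ η k (z + η) a =
      bracket τ (a - η - z) * bracketPair τ η k z (a + η) := by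
  have h := bracketPow_mul_bracket τ η k (a - η - z)
  rw [show a - η - z + 2 * η = -z + (a + η) by ring,
    show a - η - z + 2 * k * η = a + (2 * k - 1) * η - z by ring] at h
  rw [bracketPair, bracketPair, show z + (a + η) = z + η + a by ring,
    show -(z + η) + a = a - η - z by ring]
  linear_combination (bracketPow τ η k (z + η + a)) * h

lemma bracketPair_neg (τ : UpperHalfPlane) (η : ℂ) (k : ℕ) (z a : ℂ) :
    bracketPair τ η k (-z) a = bracketPair τ η k z a := by
  rw [bracketPair, bracketPair, neg_neg, mul_comm]

section local_action

variable {τ : UpperHalfPlane} {d : ℕ} {η : ℂ}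

lemma gaugeCol_unit_mul (ε : ℤˣ) (x : ℂ) : gaugeCol τ ((ε : ℤ) * x) = gaugeCol τ x := by
  rcases Int.units_eq_one_or ε with rfl | rfl <;> simp [gaugeCol_neg]

lemma gaugeRow_unit_mul (ε : ℤˣ) (x : ℂ) : gaugeRow τ ((ε : ℤ) * x) = gaugeRow τ x := by
  rcases Int.units_eq_one_or ε with rfl | rfl <;> simp [gaugeRow_neg]

lemma unit_mul_unit_mul (ε : ℤˣ) (x : ℂ) : ((ε : ℤ) : ℂ) * ((ε : ℤ) * x) = x := by
  rcases Int.units_eq_one_or ε with rfl | rfl <;> simp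

lemma nat_eq_two_mul_spin (d : ℕ) : (d : ℂ) = 2 * spin d := by
  rw [spin]; ring

/-- On a null vector, the `L`-operator maps the gauge vector `v(λ/2)` to a multiple of the gauge
vector `v(λ/2 + 2εlη)` and shifts `u` by `-2η`. -/
lemma localL_nullVec_gaugeCol (hW : ∀ a, thetaIdx τ a η ≠ 0) (ε : ℤˣ) (lam u : ℂ) (i : Fin 2) :
    ∑ j, gaugeCol τ (lam / 2) j • localL τ d η u i j (nullVec τ d η ε lam u) =
      (gaugeCol τ (lam / 2 + (ε : ℤ) * (2 * spin d * η)) i *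
        (2 * bracket τ (u + 2 * spin d * η))) • nullVec τ d η ε lam (u - 2 * η) := by
  -- Both sides are entire, so it suffices to compare them after multiplication by `θ₁₁(2z, τ)`.
  refine Subtype.ext (funext fun z => theta_cancel (τ := τ)
    (SetLike.coe_mem (p := thetaSpace τ d) _).1.continuous
    (SetLike.coe_mem (p := thetaSpace τ d) _).1.continuous (fun z => ?_) z)
  -- The gauge vectors are even, so the sign `ε` can be absorbed into the argument `x = ελ/2`.
  set x : ℂ := (ε : ℤ) * (lam / 2) with hx
  have e1 : gaugeCol τ (lam / 2) = gaugeCol τ x := (gaugeCol_unit_mul ε _).symm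
  have e2 : gaugeCol τ (lam / 2 + (ε : ℤ) * (2 * spin d * η)) =
      gaugeCol τ (x + 2 * spin d * η) := by
    rw [← gaugeCol_unit_mul ε, mul_add, unit_mul_unit_mul]
  have ha : ∀ v, ((ε : ℤ) * lam + v) / 2 + (-spin d + 1) * η =
      x + v / 2 + (-spin d + 1) * η := fun v => by rw [hx]; ring
  have hL := fun j => theta_mul_localL hW u i j (nullVec τ d η ε lam u) z
  simp only [nullVec_apply, ha] at hL
  have hw1 := gaugeRow_dotProduct_gaugeCol τ (u / 2 + z - spin d * η) x
  have hw2 := gaugeRow_dotProduct_gaugeCol τ (u / 2 - z - spin d * η) x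
  have hb1 := bracket_mul_bracketPair_add τ η d z (x + u / 2 + (-spin d + 1) * η)
  have hb2 := bracket_mul_bracketPair_add τ η d (-z) (x + u / 2 + (-spin d + 1) * η)
  rw [show -z + η = -(z - η) by ring, bracketPair_neg, bracketPair_neg] at hb2
  rw [nat_eq_two_mul_spin] at hb1 hb2
  have h3 := gaugeCol_three_term τ (u / 2 - z + spin d * η) (u / 2 + z + spin d * η)
    (x + 2 * spin d * η) i
  rw [e1, e2]
  simp only [Fin.sum_univ_two, Submodule.coe_add, SetLike.val_smul, Pi.add_apply, Pi.smul_apply,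
    smul_eq_mul, nullVec_apply, ha] at hw1 hw2 ⊢
  rw [show x + (u - 2 * η) / 2 + (-spin d + 1) * η = x + u / 2 + (-spin d + 1) * η - η by ring]
  set F1 := bracketPair τ η d (z + η) (x + u / 2 + (-spin d + 1) * η)
  set F2 := bracketPair τ η d (z - η) (x + u / 2 + (-spin d + 1) * η)
  set G := bracketPair τ η d z (x + u / 2 + (-spin d + 1) * η - η)
  -- The factors produced by pairing with `w` are those needed to shift the null vector to `G`.
  have hb1' : bracket τ (u / 2 + z - spin d * η + x) * F1 =
      bracket τ (u / 2 + z + 3 * spin d * η + x) * G := by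
    convert hb1 using 3 <;> ring
  have hb2' : bracket τ (u / 2 - z - spin d * η + x) * F2 =
      bracket τ (u / 2 - z + 3 * spin d * η + x) * G := by
    convert hb2 using 3 <;> ring
  rw [show u / 2 + z + spin d * η + (x + 2 * spin d * η) = u / 2 + z + 3 * spin d * η + x by ring,
    show u / 2 + z + spin d * η - (x + 2 * spin d * η) = u / 2 + z - spin d * η - x by ring,
    show u / 2 - z + spin d * η + (x + 2 * spin d * η) = u / 2 - z + 3 * spin d * η + x by ring,
    show u / 2 - z + spin d * η - (x + 2 * spin d * η) = u / 2 - z - spin d * η - x by ring,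
    show u / 2 + z + spin d * η + (u / 2 - z + spin d * η) = u + 2 * spin d * η by ring,
    show u / 2 + z + spin d * η - (u / 2 - z + spin d * η) = 2 * z by ring] at h3
  change _ = bracket τ (2 * z) * _
  rw [mul_add, mul_left_comm, hL 0, mul_left_comm, hL 1]
  linear_combination
    gaugeCol τ (u / 2 - z + spin d * η) i * F1 * hw1 -
      gaugeCol τ (u / 2 + z + spin d * η) i * F2 * hw2 +
      2 * gaugeCol τ (u / 2 - z + spin d * η) i *
        bracket τ (u / 2 + z - spin d * η - x) * hb1' -
      2 * gaugeCol τ (u / 2 + z + spin d * η) i *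
        bracket τ (u / 2 - z - spin d * η - x) * hb2' + 2 * G * h3

/-- On a null vector, the `L`-operator maps the annihilator `w(λ/2 + 2εlη)` of a gauge vector to a
multiple of the annihilator `w(λ/2)` and shifts `u` by `2η`. -/
lemma localL_nullVec_gaugeRow (hW : ∀ a, thetaIdx τ a η ≠ 0) (ε : ℤˣ) (lam u : ℂ) (j : Fin 2) :
    ∑ i, gaugeRow τ (lam / 2 + (ε : ℤ) * (2 * spin d * η)) i •
        localL τ d η u i j (nullVec τ d η ε lam u) =
      (gaugeRow τ (lam / 2) j * (2 * bracket τ (u - 2 * spin d * η))) •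
        nullVec τ d η ε lam (u + 2 * η) := by
  -- Both sides are entire, so it suffices to compare them after multiplication by `θ₁₁(2z, τ)`.
  refine Subtype.ext (funext fun z => theta_cancel (τ := τ)
    (SetLike.coe_mem (p := thetaSpace τ d) _).1.continuous
    (SetLike.coe_mem (p := thetaSpace τ d) _).1.continuous (fun z => ?_) z)
  set x : ℂ := (ε : ℤ) * (lam / 2) with hx
  have e1 : gaugeRow τ (lam / 2) = gaugeRow τ x := (gaugeRow_unit_mul ε _).symm
  have e2 : gaugeRow τ (lam / 2 + (ε : ℤ) * (2 * spin d * η)) =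
      gaugeRow τ (x + 2 * spin d * η) := by
    rw [← gaugeRow_unit_mul ε, mul_add, unit_mul_unit_mul]
  have ha : ∀ v, ((ε : ℤ) * lam + v) / 2 + (-spin d + 1) * η =
      x + v / 2 + (-spin d + 1) * η := fun v => by rw [hx]; ring
  have hL := fun i => theta_mul_localL hW u i j (nullVec τ d η ε lam u) z
  simp only [nullVec_apply, ha] at hL
  have hw1 := gaugeRow_dotProduct_gaugeCol τ (x + 2 * spin d * η) (u / 2 - z + spin d * η)
  have hw2 := gaugeRow_dotProduct_gaugeCol τ (x + 2 * spin d * η) (u / 2 + z + spin d * η)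
  have hb1 := bracket_mul_bracketPair_sub τ η d z (x + u / 2 + (-spin d + 1) * η)
  have hb2 := bracket_mul_bracketPair_sub τ η d (-z) (x + u / 2 + (-spin d + 1) * η)
  rw [show -z + η = -(z - η) by ring, bracketPair_neg, bracketPair_neg] at hb2
  rw [nat_eq_two_mul_spin] at hb1 hb2
  have h3 := gaugeRow_three_term τ (u / 2 - z - spin d * η) (u / 2 + z - spin d * η) x j
  rw [e1, e2]
  simp only [Fin.sum_univ_two, Submodule.coe_add, SetLike.val_smul, Pi.add_apply, Pi.smul_apply,
    smul_eq_mul, nullVec_apply, ha] at hw1 hw2 ⊢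
  rw [show x + (u + 2 * η) / 2 + (-spin d + 1) * η = x + u / 2 + (-spin d + 1) * η + η by ring]
  set F1 := bracketPair τ η d (z + η) (x + u / 2 + (-spin d + 1) * η)
  set F2 := bracketPair τ η d (z - η) (x + u / 2 + (-spin d + 1) * η)
  set G := bracketPair τ η d z (x + u / 2 + (-spin d + 1) * η + η)
  have hb1' : bracket τ (u / 2 - z + 3 * spin d * η + x) * F1 =
      bracket τ (u / 2 - z - spin d * η + x) * G := by
    convert hb1 using 3 <;> ring
  have hb2' : bracket τ (u / 2 + z + 3 * spin d * η + x) * F2 =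
      bracket τ (u / 2 + z - spin d * η + x) * G := by
    convert hb2 using 3 <;> ring
  have hneg : ∀ y, bracket τ (-y) = -bracket τ y := fun y => theta_one_one_neg y τ
  rw [show x + 2 * spin d * η + (u / 2 - z + spin d * η) = u / 2 - z + 3 * spin d * η + x by ring,
    show x + 2 * spin d * η - (u / 2 - z + spin d * η) = -(u / 2 - z - spin d * η - x) by ring,
    hneg] at hw1
  rw [show x + 2 * spin d * η + (u / 2 + z + spin d * η) = u / 2 + z + 3 * spin d * η + x by ring,
    show x + 2 * spin d * η - (u / 2 + z + spin d * η) = -(u / 2 + z - spin d * η - x) by ring,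
    hneg] at hw2
  rw [show u / 2 + z - spin d * η + (u / 2 - z - spin d * η) = u - 2 * spin d * η by ring,
    show u / 2 + z - spin d * η - (u / 2 - z - spin d * η) = 2 * z by ring] at h3
  change _ = bracket τ (2 * z) * _
  rw [mul_add, mul_left_comm, hL 0, mul_left_comm, hL 1]
  linear_combination
    gaugeRow τ (u / 2 + z - spin d * η) j * F1 * hw1 -
      gaugeRow τ (u / 2 - z - spin d * η) j * F2 * hw2 -
      2 * gaugeRow τ (u / 2 + z - spin d * η) j *
        bracket τ (u / 2 - z - spin d * η - x) * hb1' +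
      2 * gaugeRow τ (u / 2 - z - spin d * η) j *
        bracket τ (u / 2 + z - spin d * η - x) * hb2' + 2 * G * h3

end local_action

/-! ### The gauge attached to the auxiliary index -/

/-- The argument `λ_i / 2 = (2 i'' - 1) l η` of the gauge vector at the auxiliary index
`i'' = i + 1`. -/
def gaugeArg {r : ℕ} (d : ℕ) (η : ℂ) (i : Fin r) : ℂ :=
  2 * (2 * ((i : ℂ) + 1) - 1) * spin d * η / 2

/-- Either `S^{i}_{j}` vanishes, or it is given by the null vectors with a sign `ε` for which the
gauge argument moves from `j` to `i` by `2 ε l η`, up to sign and integers. At the two ends of the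
chain the closing condition uses `2 l r η ∈ ℤ`. -/
lemma sMat_cases {m r : ℕ} (τ : UpperHalfPlane) (d : ℕ) (η : ℂ) {r' : ℤ}
    (hη : 2 * spin d * r * η = r') (t : Fin m → Fin r → ℂ) (i j : Fin r) :
    (∀ u, sMat τ d η t u i j = 0) ∨ ∃ ε : ℤˣ,
      (∀ u, sMat τ d η t u i j = (∑ k : Fin m, t k j • LinearMap.proj k).smulRight
        (nullVec τ d η ε (2 * (2 * ((j : ℂ) + 1) - 1) * spin d * η) u)) ∧
      gaugeCol τ (gaugeArg d η j + (ε : ℤ) * (2 * spin d * η)) = gaugeCol τ (gaugeArg d η i) ∧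
      gaugeRow τ (gaugeArg d η j + (ε : ℤ) * (2 * spin d * η)) = gaugeRow τ (gaugeArg d η i) := by
  by_cases h1 : (i : ℕ) = j + 1 ∨ (i = j ∧ (j : ℕ) + 1 = r)
  · refine Or.inr ⟨1, fun u => by rw [sMat]; exact if_pos h1, ?_⟩
    rcases h1 with h | ⟨rfl, h⟩
    · have : gaugeArg d η j + ((1 : ℤˣ) : ℤ) * (2 * spin d * η) = gaugeArg d η i := by
        rw [gaugeArg, gaugeArg, h]
        push_cast
        ring
      rw [this]
      exact ⟨rfl, rfl⟩
    · have : gaugeArg d η i + ((1 : ℤˣ) : ℤ) * (2 * spin d * η) =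
          -gaugeArg d η i + (2 * r' : ℤ) := by
        have hr : (r : ℂ) = i + 1 := by exact_mod_cast h.symm
        rw [hr] at hη
        rw [gaugeArg]
        push_cast
        linear_combination 2 * hη
      rw [this, gaugeCol_add_int, gaugeRow_add_int, gaugeCol_neg, gaugeRow_neg]
      exact ⟨rfl, rfl⟩
  by_cases h2 : (i : ℕ) + 1 = j ∨ (i = j ∧ (j : ℕ) = 0)
  · refine Or.inr ⟨-1, fun u => by rw [sMat]; exact (if_neg h1).trans (if_pos h2), ?_⟩
    rcases h2 with h | ⟨rfl, h⟩
    · have : gaugeArg d η j + ((-1 : ℤˣ) : ℤ) * (2 * spin d * η) = gaugeArg d η i := by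
        rw [gaugeArg, gaugeArg, ← h]
        push_cast
        ring
      rw [this]
      exact ⟨rfl, rfl⟩
    · have : gaugeArg d η i + ((-1 : ℤˣ) : ℤ) * (2 * spin d * η) = -gaugeArg d η i := by
        rw [gaugeArg, h]
        push_cast
        ring
      rw [this, gaugeCol_neg, gaugeRow_neg]
      exact ⟨rfl, rfl⟩
  · exact Or.inl fun u => by rw [sMat]; exact (if_neg h1).trans (if_neg h2)

section gauge

variable {τ : UpperHalfPlane} {d : ℕ} {η : ℂ}

lemma localL_sMat_gaugeCol {m r : ℕ} (hW : ∀ a, thetaIdx τ a η ≠ 0) {r' : ℤ}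
    (hη : 2 * spin d * r * η = r') (t : Fin m → Fin r → ℂ) (u : ℂ) (i j : Fin r)
    (x : Fin m → ℂ) (a : Fin 2) :
    ∑ b, gaugeCol τ (gaugeArg d η j) b • localL τ d η u a b (sMat τ d η t u i j x) =
      (gaugeCol τ (gaugeArg d η i) a * (2 * bracket τ (u + 2 * spin d * η))) •
        sMat τ d η t (u - 2 * η) i j x := by
  rcases sMat_cases τ d η hη t i j with h | ⟨ε, h, hc, -⟩
  · simp [h]
  · simp only [h, LinearMap.smulRight_apply, map_smul]
    rw [← hc, smul_comm _ (_ : ℂ) (nullVec _ _ _ _ _ _), gaugeArg, ← localL_nullVec_gaugeCol hW,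
      Finset.smul_sum]
    exact Finset.sum_congr rfl fun b _ => smul_comm _ _ _

lemma localL_sMat_gaugeRow {m r : ℕ} (hW : ∀ a, thetaIdx τ a η ≠ 0) {r' : ℤ}
    (hη : 2 * spin d * r * η = r') (t : Fin m → Fin r → ℂ) (u : ℂ) (i j : Fin r)
    (x : Fin m → ℂ) (b : Fin 2) :
    ∑ a, gaugeRow τ (gaugeArg d η i) a • localL τ d η u a b (sMat τ d η t u i j x) =
      (gaugeRow τ (gaugeArg d η j) b * (2 * bracket τ (u - 2 * spin d * η))) •
        sMat τ d η t (u + 2 * η) i j x := by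
  rcases sMat_cases τ d η hη t i j with h | ⟨ε, h, -, hr⟩
  · simp [h]
  · simp only [h, LinearMap.smulRight_apply, map_smul]
    rw [← hr, smul_comm _ (_ : ℂ) (nullVec _ _ _ _ _ _), gaugeArg, ← localL_nullVec_gaugeRow hW,
      Finset.smul_sum]
    exact Finset.sum_congr rfl fun a _ => smul_comm _ _ _

end gauge

/-! ### Transport along the chain of sites -/

section chain

variable {N : ℕ} {τ : UpperHalfPlane} {d : ℕ} {η u : ℂ}

lemma siteOp_tprod (n : Fin N) (A : thetaSpace τ d →ₗ[ℂ] thetaSpace τ d)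
    (f : Fin N → thetaSpace τ d) :
    siteOp n A (PiTensorProduct.tprod ℂ f) =
      PiTensorProduct.tprod ℂ (Function.update f n (A (f n))) := by
  rw [siteOp, PiTensorProduct.map_tprod]
  congr 1
  funext k
  by_cases h : k = n
  · subst h; simp
  · simp [h]

lemma lOp_tprod (n : Fin N) (i j : Fin 2) (f : Fin N → thetaSpace τ d) :
    lOp N τ d η n u i j (PiTensorProduct.tprod ℂ f) =
      PiTensorProduct.tprod ℂ (Function.update f n (localL τ d η u i j (f n))) := by
  simp only [lOp, localL, LinearMap.sum_apply, LinearMap.smul_apply, siteOp_tprod,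
    MultilinearMap.map_update_sum, MultilinearMap.map_update_smul]

lemma lOp_commute {n k : Fin N} (h : n ≠ k) (i j i' j' : Fin 2) :
    Commute (lOp N τ d η n u i j) (lOp N τ d η k u i' j') := by
  refine PiTensorProduct.ext (MultilinearMap.ext fun f => ?_)
  simp only [LinearMap.compMultilinearMap_apply, Module.End.mul_apply, lOp_tprod,
    Function.update_of_ne h, Function.update_of_ne h.symm]
  rw [Function.update_comm h]

/-- The product `L_k(u) ⋯ L_1(u)` of the `L`-operators at the first `k` sites. -/
def monodromy (N : ℕ) (τ : UpperHalfPlane) (d : ℕ) (η u : ℂ) :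
    ℕ → Matrix (Fin 2) (Fin 2) (Module.End ℂ (StateSpace N τ d))
  | 0 => 1
  | k + 1 => (if h : k < N then lOp N τ d η ⟨k, h⟩ u else 1) * monodromy N τ d η u k

lemma prod_ofFn_rev {M : Type*} [Monoid M] {P A : ℕ → M} (h0 : P 0 = 1)
    (hP : ∀ k, P (k + 1) = A k * P k) (k : ℕ) :
    (List.ofFn fun n : Fin k => A n.rev).prod = P k := by
  induction k with
  | zero => simp [h0]
  | succ k ih =>
    rw [List.ofFn_succ, List.prod_cons, hP, ← ih]
    simp only [Fin.rev_zero, Fin.val_last, Fin.rev_succ, Fin.val_castSucc]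

lemma transfer_eq_trace_monodromy :
    transfer N τ d η u = Matrix.trace (monodromy N τ d η u N) := by
  rw [transfer, ← prod_ofFn_rev (P := monodromy N τ d η u)
    (A := fun k => if h : k < N then lOp N τ d η ⟨k, h⟩ u else 1) rfl (fun k => rfl)]
  simp only [Fin.is_lt, dif_pos, Fin.eta]

lemma monodromy_zero_apply (i j : Fin 2) (ψ : StateSpace N τ d) :
    monodromy N τ d η u 0 i j ψ = if i = j then ψ else 0 := by
  rw [monodromy, Matrix.one_apply]
  split_ifs <;> rfl

lemma monodromy_succ_apply {k : ℕ} (hk : k < N) (i j : Fin 2) (ψ : StateSpace N τ d) :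
    monodromy N τ d η u (k + 1) i j ψ =
      ∑ b, lOp N τ d η ⟨k, hk⟩ u i b (monodromy N τ d η u k b j ψ) := by
  rw [monodromy, dif_pos hk, Matrix.mul_apply, LinearMap.sum_apply]
  rfl

lemma lOp_commute_monodromy {n : Fin N} {k : ℕ} (h : k ≤ n) (i j i' j' : Fin 2) :
    Commute (lOp N τ d η n u i j) (monodromy N τ d η u k i' j') := by
  induction k generalizing i' j' with
  | zero =>
    rw [monodromy, Matrix.one_apply]
    split_ifs
    · exact Commute.one_right _
    · exact Commute.zero_right _
  | succ k ih =>
    have hk : k < N := (Nat.lt_of_succ_le h).trans n.isLt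
    rw [monodromy, dif_pos hk, Matrix.mul_apply]
    refine Commute.sum_right _ _ _ fun b _ => Commute.mul_right (lOp_commute ?_ _ _ _ _)
      (ih (Nat.le_of_succ_le h) _ _)
    rintro rfl
    exact absurd h (Nat.not_succ_le_self k)

lemma update_ite_lt {V : Type*} (f g : Fin N → V) {k : ℕ} (hk : k < N) :
    Function.update (fun n : Fin N => if (n : ℕ) < k then g n else f n) ⟨k, hk⟩ (g ⟨k, hk⟩) =
      fun n : Fin N => if (n : ℕ) < k + 1 then g n else f n := by
  funext n
  by_cases h : n = ⟨k, hk⟩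
  · subst h; simp
  · have : (n : ℕ) ≠ k := fun h' => h (Fin.ext h')
    rw [Function.update_of_ne h]
    have e : (n : ℕ) < k + 1 ↔ (n : ℕ) < k := by omega
    simp only [e]

/-- Column vectors transported by every local `L`-operator are transported by the monodromy. -/
lemma monodromy_transport_col {f g : Fin N → thetaSpace τ d} {v : ℕ → Fin 2 → ℂ} {c : ℂ}
    (H : ∀ (n : Fin N) (i : Fin 2),
      ∑ j, v n j • localL τ d η u i j (f n) = (v (n + 1) i * c) • g n)
    {k : ℕ} (hk : k ≤ N) (i : Fin 2) :
    ∑ j, v 0 j • monodromy N τ d η u k i j (PiTensorProduct.tprod ℂ f) =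
      (v k i * c ^ k) • PiTensorProduct.tprod ℂ fun n : Fin N => if (n : ℕ) < k then g n else f n := by
  induction k generalizing i with
  | zero =>
    simp [monodromy_zero_apply]
  | succ k ih =>
    have hk' : k < N := hk
    calc ∑ j, v 0 j • monodromy N τ d η u (k + 1) i j (PiTensorProduct.tprod ℂ f)
        = ∑ b, lOp N τ d η ⟨k, hk'⟩ u i b
            (∑ j, v 0 j • monodromy N τ d η u k b j (PiTensorProduct.tprod ℂ f)) := by
          simp only [monodromy_succ_apply hk', Finset.smul_sum, map_sum, map_smul]
          exact Finset.sum_comm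
      _ = c ^ k • PiTensorProduct.tprod ℂ
            (Function.update (fun n : Fin N => if (n : ℕ) < k then g n else f n) ⟨k, hk'⟩
              (∑ b, v k b • localL τ d η u i b (f ⟨k, hk'⟩))) := by
          simp only [ih hk'.le, map_smul, lOp_tprod, lt_irrefl, if_false,
            MultilinearMap.map_update_sum, MultilinearMap.map_update_smul, Finset.smul_sum,
            smul_smul, mul_comm]
      _ = _ := by
          rw [H ⟨k, hk'⟩ i, MultilinearMap.map_update_smul, update_ite_lt f g hk', smul_smul,
            pow_succ]
          ring_nf

/-- Row vectors transported by every local `L`-operator are transported by the monodromy; here the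
last site is moved past the others, on which it does not act. -/
lemma monodromy_transport_row {f g : Fin N → thetaSpace τ d} {w : ℕ → Fin 2 → ℂ} {c : ℂ}
    {k : ℕ} (hk : k ≤ N) (H : ∀ (n : Fin N) (j : Fin 2), (n : ℕ) < k →
      ∑ i, w (n + 1) i • localL τ d η u i j (f n) = (w n j * c) • g n) (j : Fin 2) :
    ∑ i, w k i • monodromy N τ d η u k i j (PiTensorProduct.tprod ℂ f) =
      (w 0 j * c ^ k) • PiTensorProduct.tprod ℂ fun n : Fin N => if (n : ℕ) < k then g n else f n := by
  induction k generalizing f with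
  | zero =>
    simp [monodromy_zero_apply]
  | succ k ih =>
    have hk' : k < N := hk
    have hne : ∀ n : Fin N, (n : ℕ) < k → n ≠ ⟨k, hk'⟩ := fun n hn h => by simp [h] at hn
    calc ∑ i, w (k + 1) i • monodromy N τ d η u (k + 1) i j (PiTensorProduct.tprod ℂ f)
        = ∑ b, monodromy N τ d η u k b j
            (∑ i, w (k + 1) i • lOp N τ d η ⟨k, hk'⟩ u i b (PiTensorProduct.tprod ℂ f)) := by
          simp only [monodromy_succ_apply hk', Finset.smul_sum, map_sum, map_smul]
          rw [Finset.sum_comm]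
          refine Finset.sum_congr rfl fun b _ => Finset.sum_congr rfl fun i _ => ?_
          have hc := lOp_commute_monodromy (τ := τ) (d := d) (η := η) (u := u)
            (n := ⟨k, hk'⟩) le_rfl i b b j
          rw [← Module.End.mul_apply, hc.eq, Module.End.mul_apply]
      _ = c • ∑ b, w k b • monodromy N τ d η u k b j (PiTensorProduct.tprod ℂ
            (Function.update f ⟨k, hk'⟩ (g ⟨k, hk'⟩))) := by
          rw [Finset.smul_sum]
          refine Finset.sum_congr rfl fun b _ => ?_
          simp only [lOp_tprod, ← MultilinearMap.map_update_smul, ← MultilinearMap.map_update_sum]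
          rw [H ⟨k, hk'⟩ b (Nat.lt_succ_self k), MultilinearMap.map_update_smul, map_smul,
            smul_smul, mul_comm c]
      _ = _ := by
          rw [ih hk'.le fun n b hn => by
            rw [Function.update_of_ne (hne n hn)]
            exact H n b (hn.trans (Nat.lt_succ_self k)), smul_smul, pow_succ, mul_comm c, mul_assoc]
          congr 2
          rw [← update_ite_lt f g hk']
          funext n
          by_cases h : n = ⟨k, hk'⟩
          · subst h; simp
          · simp only [Function.update_of_ne h]

/-- If a `2 × 2` matrix is triangular in a basis whose first vector is `(w₁, -w₀)`, with diagonal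
entries `Y` and `Z`, then its trace is `Y + Z`. Triangularity is expressed by `(w₁, -w₀)` being a
column eigenvector for `Y` and its annihilator `(w₀, w₁)` a row eigenvector for `Z`. -/
lemma add_eq_of_eigenvectors {V : Type*} [AddCommGroup V] [Module ℂ V] {X : Fin 2 → Fin 2 → V}
    {Y Z : V} {v w : Fin 2 → ℂ} (hvw : v = ![w 1, -w 0]) (hw : w ≠ 0)
    (hY : ∀ i, ∑ j, v j • X i j = v i • Y) (hZ : ∀ j, ∑ i, w i • X i j = w j • Z) :
    X 0 0 + X 1 1 = Y + Z := by
  have hY0 := hY 0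
  have hY1 := hY 1
  have hZ0 := hZ 0
  have hZ1 := hZ 1
  simp only [Fin.sum_univ_two, hvw, Matrix.cons_val_zero, Matrix.cons_val_one] at hY0 hY1 hZ0 hZ1
  by_cases h0 : w 0 = 0
  · have h1 : w 1 ≠ 0 := fun h1 => hw (by ext i; fin_cases i <;> simp [h0, h1])
    refine smul_right_injective V h1 ?_
    simp only [h0] at hY0 hZ1
    linear_combination (norm := module) hY0 + hZ1
  · refine smul_right_injective V h0 ?_
    linear_combination (norm := module) hZ0 - hY1

/-- The action of the transfer matrix on a product state, when the local `L`-operators transport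
closed chains of column vectors and of their annihilators. -/
lemma transfer_tprod {f g g' : Fin N → thetaSpace τ d} {v w : ℕ → Fin 2 → ℂ} {c c' : ℂ}
    (hvw : v 0 = ![w 0 1, -w 0 0]) (hw : w 0 ≠ 0) (hvN : v N = v 0) (hwN : w N = w 0)
    (Hv : ∀ (n : Fin N) (i : Fin 2),
      ∑ j, v n j • localL τ d η u i j (f n) = (v (n + 1) i * c) • g n)
    (Hw : ∀ (n : Fin N) (j : Fin 2),
      ∑ i, w (n + 1) i • localL τ d η u i j (f n) = (w n j * c') • g' n) :
    transfer N τ d η u (PiTensorProduct.tprod ℂ f) =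
      c ^ N • PiTensorProduct.tprod ℂ g + c' ^ N • PiTensorProduct.tprod ℂ g' := by
  have h1 := fun i => monodromy_transport_col Hv le_rfl i
  have h2 := fun j => monodromy_transport_row le_rfl (fun n j _ => Hw n j) j
  simp only [Fin.is_lt, if_true, hvN, hwN, mul_smul] at h1 h2
  rw [transfer_eq_trace_monodromy, Matrix.trace, Fin.sum_univ_two]
  exact add_eq_of_eigenvectors
    (X := fun i j => monodromy N τ d η u N i j (PiTensorProduct.tprod ℂ f)) hvw hw h1 h2

end chain

end EightVertex

end

/-! ### Baxter's relation -/

/-- Baxter's relation `T(u) Q_R(u) = h₋(u) Q_R(u - 2η) + h₊(u) Q_R(u + 2η)`. Here `d = 2 l` is twice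
the spin and `η = r' / (2 l r)`; the range of `η` is `|η| ≤ 1 / (2 (2 l + 1))`. -/
theorem mainTheorem1 (N : ℕ) [NeZero N] (d : ℕ) (hd : 0 < d) (hNl : Even (N * d))
    (τ : UpperHalfPlane) (hτ : τ.re = 0) (r : ℕ) (hr : 0 < r) (r' : ℤ) (η : ℝ)
    (hη : η = (r' : ℝ) / ((d : ℝ) * (r : ℝ))) (hη0 : η ≠ 0)
    (hη1 : |η| ≤ 1 / (2 * ((d : ℝ) + 1)))
    (m : ℕ) (t : Fin m → Fin r → ℂ) (u : ℂ) :
    transfer N τ d (η : ℂ) u ∘ₗ qR N τ d (η : ℂ) t u =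
      hFun N τ d (η : ℂ) (-1) u • qR N τ d (η : ℂ) t (u - 2 * (η : ℂ)) +
        hFun N τ d (η : ℂ) 1 u • qR N τ d (η : ℂ) t (u + 2 * (η : ℂ)) := by
  have hd1 : (1 : ℝ) ≤ d := by exact_mod_cast hd
  have hlt : |η| < 1 / 2 := hη1.trans_lt
    (one_div_lt_one_div_of_lt (by norm_num) (by linarith))
  have hW : ∀ a, thetaIdx τ a (η : ℂ) ≠ 0 := fun a => thetaIdx_ne_zero τ a hη0 hlt
  have hη' : 2 * spin d * r * (η : ℂ) = r' := by
    have : (d : ℝ) * r * η = r' := by rw [hη]; field_simp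
    rw [← nat_eq_two_mul_spin]
    exact_mod_cast this
  refine PiTensorProduct.ext (MultilinearMap.ext fun x => ?_)
  simp only [LinearMap.compMultilinearMap_apply, LinearMap.comp_apply, LinearMap.add_apply,
    LinearMap.smul_apply, qR, LinearMap.sum_apply, PiTensorProduct.map_tprod, map_sum,
    Finset.smul_sum, ← Finset.sum_add_distrib]
  refine Finset.sum_congr rfl fun p _ => ?_
  -- The path `p` visits the auxiliary index `p (k - 1)` just before the site with index `k`.
  have h0 : ∀ n : Fin N, Fin.ofNat N n - 1 = n - 1 := fun n => by
    rw [Fin.ofNat_eq_cast, Fin.cast_val_eq_self]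
  have h1 : ∀ n : Fin N, Fin.ofNat N (n + 1) - 1 = n := fun n => by
    rw [sub_eq_iff_eq_add]
    ext
    simp [Fin.val_add]
  have hN : Fin.ofNat N N = Fin.ofNat N 0 := by
    ext; simp
  have key := transfer_tprod (N := N) (τ := τ) (d := d) (η := η) (u := u)
    (f := fun n => sMat τ d η t u (p n) (p (n - 1)) (x n))
    (g := fun n => sMat τ d η t (u - 2 * η) (p n) (p (n - 1)) (x n))
    (g' := fun n => sMat τ d η t (u + 2 * η) (p n) (p (n - 1)) (x n))
    (v := fun k => gaugeCol τ (gaugeArg d η (p (Fin.ofNat N k - 1))))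
    (w := fun k => gaugeRow τ (gaugeArg d η (p (Fin.ofNat N k - 1))))
    rfl (gaugeRow_ne_zero τ _) (by simp only [hN]) (by simp only [hN])
    (fun n i => by
      rw [h0, h1]
      exact localL_sMat_gaugeCol hW hη' t u (p n) (p (n - 1)) (x n) i)
    (fun n j => by
      rw [h0, h1]
      exact localL_sMat_gaugeRow hW hη' t u (p n) (p (n - 1)) (x n) j)
  rw [key, hFun, hFun]
  simp
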